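/- Let $B_3=\langle \sigma_1,\sigma_2 \mid \sigma_1\sigma_2\sigma_1=\sigma_2\sigma_1\sigma_2\rangle$ be the braid group on three strands, and let $F_3$ be the free group on $x_1,x_2,x_3$. Let $B_3$ act on $F_3$ on the right by automorphisms through the Artin action, $x\mapsto x^{\beta}$ with $x^{\beta\gamma}=(x^{\beta})^{\gamma}$, determined for $i\in\{1,2\}$ by $x_i^{\sigma_i}=x_ix_{i+1}x_i^{-1}$, $x_{i+1}^{\sigma_i}=x_i$, and $x_j^{\sigma_i}=x_j$ for $j\neq i,i+1$. A bi-ordering of a group $G$ is a strict total ordering $<$ of $G$ such that $f<g$ implies $hf<hg$ and $fh<gh$ for all $f,g,h\in G$. A braid $\beta\in B_3$ is called order-preserving if there is a bi-ordering $<$ of $F_3$ such that, for all $f,g\in F_3$, $f<g$ if and only if $f^{\beta}<g^{\beta}$. Then for every $\beta\in B_3$ there exists an integer $k$ with $0\le k\le 3$ such that $\beta\sigma_1^k$ is order-preserving. -/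

import Mathlib

/-- A bi-ordering of a group `G`: a strict total ordering of `G` that is invariant under
multiplication from the left and from the right. -/
structure IsBiOrdering {G : Type*} [Group G] (lt : G → G → Prop) : Prop where
  strictTotal : IsStrictTotalOrder G lt
  mul_left : ∀ f g h : G, lt f g → lt (h * f) (h * g)
  mul_right : ∀ f g h : G, lt f g → lt (f * h) (g * h)

/-- An automorphism `φ` of a group `G` is order-preserving if some bi-ordering of `G` is invariant
under `φ`. -/
def IsOrderPreservingAut {G : Type*} [Group G] (φ : MulAut G) : Prop :=
  ∃ lt : G → G → Prop, IsBiOrdering lt ∧ ∀ f g : G, lt f g ↔ lt (φ f) (φ g)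

/-- The defining relators of the braid group on `n` strands. The standard generators
`σ₁, …, σₙ₋₁` are indexed by `0, …, n - 2`. -/
inductive BraidRel (n : ℕ) : FreeGroup (Fin (n - 1)) → Prop
  /-- `σᵢ σⱼ σᵢ = σⱼ σᵢ σⱼ` for `j = i + 1`. -/
  | braid (i j : Fin (n - 1)) (h : i.val + 1 = j.val) :
      BraidRel n (FreeGroup.of i * FreeGroup.of j * FreeGroup.of i *
        (FreeGroup.of j * FreeGroup.of i * FreeGroup.of j)⁻¹)
  /-- `σᵢ σⱼ = σⱼ σᵢ` for `|i - j| > 1` (by symmetry, `i + 1 < j` suffices). -/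
  | comm (i j : Fin (n - 1)) (h : i.val + 1 < j.val) :
      BraidRel n (FreeGroup.of i * FreeGroup.of j * (FreeGroup.of j * FreeGroup.of i)⁻¹)

/-- The braid group `Bₙ`. -/
abbrev BraidGroup (n : ℕ) : Type :=
  PresentedGroup {r : FreeGroup (Fin (n - 1)) | BraidRel n r}

namespace BraidGroup

/-- The standard generators of the braid group; `sigma i` is `σᵢ₊₁` in the usual 1-based
numbering. -/
def sigma {n : ℕ} (i : Fin (n - 1)) : BraidGroup n := PresentedGroup.of i

/-- The index `i`, as a strand (0-based numbering). -/
def fst {n : ℕ} (i : Fin (n - 1)) : Fin n := ⟨i.val, by omega⟩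

/-- The index `i + 1`, as a strand (0-based numbering). -/
def snd {n : ℕ} (i : Fin (n - 1)) : Fin n := ⟨i.val + 1, by omega⟩

theorem snd_ne_fst {n : ℕ} (i : Fin (n - 1)) : snd i ≠ fst i := by
  simp [fst, snd]

/-- The endomorphism `xᵢ ↦ xᵢ xᵢ₊₁ xᵢ⁻¹`, `xᵢ₊₁ ↦ xᵢ`, `xⱼ ↦ xⱼ` for `j ≠ i, i + 1`
of the free group. -/
def artinHom {n : ℕ} (i : Fin (n - 1)) : FreeGroup (Fin n) →* FreeGroup (Fin n) :=
  FreeGroup.lift fun j =>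
    if j = fst i then
      FreeGroup.of (fst i) * FreeGroup.of (snd i) * (FreeGroup.of (fst i))⁻¹
    else if j = snd i then FreeGroup.of (fst i)
    else FreeGroup.of j

/-- The inverse of `artinHom i`. -/
def artinInvHom {n : ℕ} (i : Fin (n - 1)) : FreeGroup (Fin n) →* FreeGroup (Fin n) :=
  FreeGroup.lift fun j =>
    if j = fst i then FreeGroup.of (snd i)
    else if j = snd i then
      (FreeGroup.of (snd i))⁻¹ * FreeGroup.of (fst i) * FreeGroup.of (snd i)
    else FreeGroup.of j

theorem artinInvHom_comp_artinHom {n : ℕ} (i : Fin (n - 1)) :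
    (artinInvHom i).comp (artinHom i) = MonoidHom.id (FreeGroup (Fin n)) := by
  have hne := snd_ne_fst i
  ext j
  by_cases h₁ : j = fst i
  · subst h₁; simp [artinHom, artinInvHom, hne, mul_assoc]
  · by_cases h₂ : j = snd i
    · subst h₂; simp [artinHom, artinInvHom, hne]
    · simp [artinHom, artinInvHom, h₁, h₂]

theorem artinHom_comp_artinInvHom {n : ℕ} (i : Fin (n - 1)) :
    (artinHom i).comp (artinInvHom i) = MonoidHom.id (FreeGroup (Fin n)) := by
  have hne := snd_ne_fst i
  ext j
  by_cases h₁ : j = fst i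
  · subst h₁; simp [artinHom, artinInvHom, hne]
  · by_cases h₂ : j = snd i
    · subst h₂; simp [artinHom, artinInvHom, hne, mul_assoc]
    · simp [artinHom, artinInvHom, h₁, h₂]

/-- The Artin automorphism of the free group `Fₙ` given by the generator `sigma i`. -/
def artinGen {n : ℕ} (i : Fin (n - 1)) : MulAut (FreeGroup (Fin n)) :=
  MonoidHom.toMulEquiv (artinHom i) (artinInvHom i)
    (artinInvHom_comp_artinHom i) (artinHom_comp_artinInvHom i)

theorem artinGen_of {n : ℕ} (i : Fin (n - 1)) (j : Fin n) :
    artinGen i (FreeGroup.of j) =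
      if j = fst i then
        FreeGroup.of (fst i) * FreeGroup.of (snd i) * (FreeGroup.of (fst i))⁻¹
      else if j = snd i then FreeGroup.of (fst i)
      else FreeGroup.of j := by
  simp [artinGen, artinHom]

theorem mulAut_ext {n : ℕ} {a b : MulAut (FreeGroup (Fin n))}
    (h : ∀ k : Fin n, a (FreeGroup.of k) = b (FreeGroup.of k)) : a = b := by
  have : a.toMonoidHom = b.toMonoidHom := FreeGroup.ext_hom _ _ h
  exact MulEquiv.ext fun x => DFunLike.congr_fun this x

theorem artinGen_braid {n : ℕ} (i j : Fin (n - 1)) (h : i.val + 1 = j.val) :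
    artinGen i * artinGen j * artinGen i = artinGen j * artinGen i * artinGen j := by
  have h₀ : fst j = snd i := by simp [fst, snd, h]
  have h₁ := snd_ne_fst i
  have h₂ : snd j ≠ snd i := h₀ ▸ snd_ne_fst j
  have h₃ : snd j ≠ fst i := by
    intro e
    have := congrArg Fin.val e
    simp only [fst, snd] at this
    omega
  apply mulAut_ext
  intro k
  by_cases c₁ : k = fst i
  · subst c₁
    simp [artinGen_of, h₀, h₁, h₂, h₃, h₁.symm, h₃.symm, mul_assoc]
  · by_cases c₂ : k = snd i
    · subst c₂
      simp [artinGen_of, h₀, h₁, h₂, h₃, h₁.symm, h₃.symm]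
    · by_cases c₃ : k = snd j
      · subst c₃
        simp [artinGen_of, h₀, h₁, h₂, h₃, h₁.symm, h₃.symm]
      · simp [artinGen_of, h₀, c₁, c₂, c₃]

theorem artinGen_comm {n : ℕ} (i j : Fin (n - 1)) (h : i.val + 1 < j.val) :
    artinGen i * artinGen j = artinGen j * artinGen i := by
  have h₁ : fst j ≠ fst i := by simp [fst, Fin.ext_iff]; omega
  have h₂ : fst j ≠ snd i := by simp [fst, snd, Fin.ext_iff]; omega
  have h₃ : snd j ≠ fst i := by simp [fst, snd, Fin.ext_iff]; omega
  have h₄ : snd j ≠ snd i := by simp [snd, Fin.ext_iff]; omega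
  have h₅ := snd_ne_fst i
  have h₆ := snd_ne_fst j
  apply mulAut_ext
  intro k
  by_cases c₁ : k = fst i
  · subst c₁
    simp [artinGen_of, h₁.symm, h₂.symm, h₃.symm, h₄.symm]
  · by_cases c₂ : k = snd i
    · subst c₂
      simp [artinGen_of, h₁.symm, h₂.symm, h₃.symm, h₄.symm, h₅]
    · by_cases c₃ : k = fst j
      · subst c₃
        simp [artinGen_of, h₁, h₂, h₃, h₄]
      · by_cases c₄ : k = snd j
        · subst c₄
          simp [artinGen_of, h₁, h₂, h₃, h₄, h₆]
        · simp [artinGen_of, c₁, c₂, c₃, c₄]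

theorem artinGen_rel {n : ℕ} (r : FreeGroup (Fin (n - 1))) (hr : BraidRel n r) :
    FreeGroup.lift (fun i => MulOpposite.op (artinGen (n := n) i)) r = 1 := by
  cases hr with
  | braid i j h =>
    simp only [map_mul, map_inv, FreeGroup.lift_apply_of, mul_inv_eq_one, ← MulOpposite.op_mul]
    rw [← mul_assoc, ← mul_assoc, artinGen_braid i j h]
  | comm i j h =>
    simp only [map_mul, map_inv, FreeGroup.lift_apply_of, mul_inv_eq_one, ← MulOpposite.op_mul]
    rw [artinGen_comm i j h]

/-- The Artin action of `Bₙ` on the free group `Fₙ`. It is a right action: a product `β * γ` acts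
first by `β` and then by `γ`; hence a homomorphism to the opposite of the automorphism group. -/
def artin (n : ℕ) : BraidGroup n →* (MulAut (FreeGroup (Fin n)))ᵐᵒᵖ :=
  PresentedGroup.toGroup (rels := {r : FreeGroup (Fin (n - 1)) | BraidRel n r})
    (f := fun i => MulOpposite.op (artinGen i)) artinGen_rel

/-- The automorphism `x ↦ x ^ β` of `Fₙ` induced by a braid `β`. -/
def artinAut {n : ℕ} (β : BraidGroup n) : MulAut (FreeGroup (Fin n)) :=
  (artin n β).unop

/-- A braid is order-preserving if the automorphism of `Fₙ` that it induces through the Artin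
action is order-preserving. -/
def IsOrderPreserving {n : ℕ} (β : BraidGroup n) : Prop :=
  IsOrderPreservingAut (artinAut β)

end BraidGroup

/-! Let I be the augmentation ideal of the integral group ring of a free group. Leading terms in the
I-adic filtration give bi-orderings. Choose real families `ι n` on the basis, each linearly
independent over a countable field containing all earlier ones. The functional `corner ι n` sends
(b₁ - 1)⋯(bₙ - 1) to ι (n-1) b₁ ⋯ ι 0 bₙ. Independence makes it injective on Iⁿ/Iⁿ⁺¹
(`mem_augPow_succ_of_corner_eq_zero`), and residual nilpotence (`eq_one_of_forall_mem_augPow`) gives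
every nontrivial element a leading term. The sign of that term defines `posCone`, which is respected
by every endomorphism scaling each character `ι n` by a positive factor (`map_mem_posCone`).

Pure braids fix all real characters of F₃, so they are order-preserving. For other braids write F₃ =
K ⋊ ℤ with K the kernel of the total exponent, free on ℤ × {0, 1}. A braid maps the character (m, i)
↦ t^m v_i of K to the one given by its reduced Burau matrix applied to v (`genDiff_comp_artinAut`),
so an eigenvector with positive eigenvalue yields a scaled character, and K ⋊ ℤ is ordered
lexicographically. If the Burau determinant is -T^e with e odd, it is negative at every t > 0, so a
positive eigenvalue l exists. For t transcendental over E, the numbers t^m v_i are independent over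
E as soon as l ∉ E(t). If l ∈ E(t), then τ² + 4T^e, with τ the trace, is a square, which forces
τ(-1) = ±2 (`sq_eval_neg_one_of_sq_eq`).

It remains to multiply by a power of σ₁. Let c be the upper right entry of the Burau matrix at -1;
its parity is read off from the permutation. If c is even, the braid or its product with σ₁ is pure.
If c is odd, at most one factor σ₁ makes e odd without changing c, and a further σ₁² changes the
trace by 2c, away from ±2 if it was there. -/

/-! ### Powers of the augmentation ideal. -/

section Filtration

variable {K : Type*} [Group K]

/-- The powers of the augmentation ideal of the integral group ring. -/
noncomputable def augPow (K : Type*) [Group K] : ℕ → Submodule ℤ (MonoidAlgebra ℤ K)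
  | 0 => ⊤
  | n + 1 => Submodule.span ℤ
      {z | ∃ (k : K) (x : MonoidAlgebra ℤ K), x ∈ augPow K n ∧
        z = (MonoidAlgebra.of ℤ K k - 1) * x}

open MonoidAlgebra in
theorem sub_one_mul_mem_augPow {n : ℕ} (k : K) {x : MonoidAlgebra ℤ K} (hx : x ∈ augPow K n) :
    (of ℤ K k - 1) * x ∈ augPow K (n + 1) :=
  Submodule.subset_span ⟨k, x, hx, rfl⟩

open MonoidAlgebra in
theorem augPow_succ_le_of {n : ℕ} {S : Submodule ℤ (MonoidAlgebra ℤ K)}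
    (h : ∀ k x, x ∈ augPow K n → (of ℤ K k - 1) * x ∈ S) : augPow K (n + 1) ≤ S :=
  Submodule.span_le.2 <| by
    rintro _ ⟨k, x, hx, rfl⟩
    exact h k x hx

theorem augPow_succ_le (n : ℕ) : augPow K (n + 1) ≤ augPow K n := by
  induction n with
  | zero => exact le_top
  | succ n ih => exact augPow_succ_le_of fun k x hx => sub_one_mul_mem_augPow k (ih hx)

theorem augPow_antitone : Antitone (augPow K) := antitone_nat_of_succ_le augPow_succ_le

open MonoidAlgebra in
-- The identity k(l - 1) = (klk⁻¹ - 1)k passes k through the leading factor, so each power is a left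
-- ideal.
theorem of_mul_mem_augPow {n : ℕ} {x : MonoidAlgebra ℤ K} (hx : x ∈ augPow K n) (k : K) :
    of ℤ K k * x ∈ augPow K n := by
  induction n generalizing x with
  | zero => trivial
  | succ n ih =>
    have : augPow K (n + 1) ≤ (augPow K (n + 1)).comap (LinearMap.mulLeft ℤ (of ℤ K k)) :=
      augPow_succ_le_of fun l x hx => by
        have e : of ℤ K k * ((of ℤ K l - 1) * x)
            = (of ℤ K (k * l * k⁻¹) - 1) * (of ℤ K k * x) := by
          rw [← mul_assoc, ← mul_assoc, mul_sub, sub_mul (of ℤ K (k * l * k⁻¹)), ← map_mul,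
            ← map_mul]
          simp
        rw [Submodule.mem_comap, LinearMap.mulLeft_apply, e]
        exact sub_one_mul_mem_augPow _ (ih hx)
    exact this hx

open MonoidAlgebra in
theorem sub_one_mem_augPow_one (k : K) : of ℤ K k - 1 ∈ augPow K 1 := by
  simpa using sub_one_mul_mem_augPow (n := 0) k (x := 1) trivial

/-- The ring endomorphism of the group ring induced by an endomorphism of the group. -/
noncomputable def groupRingMap (ψ : K →* K) : MonoidAlgebra ℤ K →ₐ[ℤ] MonoidAlgebra ℤ K :=
  MonoidAlgebra.lift ℤ _ _ ((MonoidAlgebra.of ℤ K).comp ψ)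

theorem groupRingMap_of (ψ : K →* K) (k : K) :
    groupRingMap ψ (MonoidAlgebra.of ℤ K k) = MonoidAlgebra.of ℤ K (ψ k) := by
  simp [groupRingMap]

theorem groupRingMap_mem_augPow (ψ : K →* K) {n : ℕ} {x : MonoidAlgebra ℤ K}
    (hx : x ∈ augPow K n) : groupRingMap ψ x ∈ augPow K n := by
  induction n generalizing x with
  | zero => trivial
  | succ n ih =>
    have : augPow K (n + 1) ≤ (augPow K (n + 1)).comap (groupRingMap ψ).toLinearMap :=
      augPow_succ_le_of fun k x hx => by
        simpa only [Submodule.mem_comap, AlgHom.toLinearMap_apply, map_mul, map_sub, map_one,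
          groupRingMap_of] using sub_one_mul_mem_augPow (ψ k) (ih hx)
    exact this hx

end Filtration

/-! ### Residual nilpotence of free groups, by a Magnus-type representation. -/

section Residual

variable {B : Type*}

open Classical in
/-- The operator on functions of words that strips a first letter `b` not followed by a further
`b`. -/
noncomputable def stripOp (b : B) : Module.End ℤ (List B → ℤ) where
  toFun f u := match u with
    | [] => 0
    | a :: v => if a = b ∧ v.head? ≠ some b then f v else 0
  map_add' f g := by
    funext u
    cases u with
    | nil => simp
    | cons a v => simp only [Pi.add_apply]; split_ifs <;> simp
  map_smul' c f := by
    funext u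
    cases u with
    | nil => simp
    | cons a v => simp only [Pi.smul_apply]; split_ifs <;> simp

theorem stripOp_nil (b : B) (f : List B → ℤ) : stripOp b f [] = 0 := rfl

open Classical in
theorem stripOp_cons (b a : B) (v : List B) (f : List B → ℤ) :
    stripOp b f (a :: v) = if a = b ∧ v.head? ≠ some b then f v else 0 := rfl

/-- The ban on a second `b` is made for this: a syllable b^m then acts as 1 + m · `stripOp b`. -/
theorem stripOp_mul_self (b : B) : stripOp b * stripOp b = 0 := by
  ext f u
  change stripOp b (stripOp b f) u = 0
  rcases u with _ | ⟨a, _ | ⟨c, v⟩⟩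
  · rfl
  · rw [stripOp_cons]
    split_ifs <;> rfl
  · rw [stripOp_cons]
    split_ifs with h
    · rw [stripOp_cons, if_neg]
      rintro ⟨rfl, -⟩
      simp at h
    · rfl

/-- The unipotent operators `1 + stripOp b`. -/
noncomputable def stripUnit (b : B) : (Module.End ℤ (List B → ℤ))ˣ where
  val := 1 + stripOp b
  inv := 1 - stripOp b
  val_inv := by
    rw [mul_sub, mul_one, add_mul, one_mul, stripOp_mul_self]
    abel
  inv_val := by
    rw [mul_add, mul_one, sub_mul, one_mul, stripOp_mul_self]
    abel

/-- The representation of the free group by the operators `stripUnit b`. -/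
noncomputable def stripRep : FreeGroup B →* (Module.End ℤ (List B → ℤ))ˣ :=
  FreeGroup.lift stripUnit

/-- The word function that is `1` on the empty word and `0` elsewhere. -/
noncomputable def nilFun : List B → ℤ := fun u => match u with
  | [] => 1
  | _ :: _ => 0

/-- The sign of an exponent of a letter in a word of the free group. -/
def letterSign (s : Bool) : ℤ := if s then 1 else -1

theorem stripRep_mk_cons (b : B) (s : Bool) (L : List (B × Bool)) (f : List B → ℤ) :
    ((stripRep (FreeGroup.mk ((b, s) :: L))).val f) =
      (stripRep (FreeGroup.mk L)).val f +
        letterSign s • stripOp b ((stripRep (FreeGroup.mk L)).val f) := by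
  have h : FreeGroup.mk ((b, s) :: L) = FreeGroup.mk [(b, s)] * FreeGroup.mk L := by
    simp [FreeGroup.mul_mk]
  have h2 : (stripRep (FreeGroup.mk [(b, s)])).val = 1 + letterSign s • stripOp b := by
    cases s
    · simp [stripRep, letterSign, FreeGroup.lift_mk, stripUnit, sub_eq_add_neg]
    · simp [stripRep, letterSign, FreeGroup.lift_mk, stripUnit]
  rw [h, map_mul, Units.val_mul, h2]
  rfl

/-- Applied to `nilFun`, a reduced word with syllables b₁^m₁ ⋯ b_r^m_r takes the value m₁⋯m_r at the
list b₁, …, b_r. Here `u` is b₂, …, b_r and `m` is |m₁|. The last two clauses keep the induction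
going: they kill the extra terms when a letter prolongs the first syllable or opens a new one. -/
theorem exists_strip_coeff_ne_zero (b : B) (s : Bool) (L : List (B × Bool))
    (hL : FreeGroup.IsReduced ((b, s) :: L)) :
    ∃ (u : List B) (m : ℤ), u.head? ≠ some b ∧ 0 < m ∧
      (stripRep (FreeGroup.mk ((b, s) :: L))).val nilFun u ≠ 0 ∧
      (stripRep (FreeGroup.mk ((b, s) :: L))).val nilFun (b :: u) =
        letterSign s * m * (stripRep (FreeGroup.mk ((b, s) :: L))).val nilFun u ∧
      (∀ v : List B, u.length + 1 < v.length →
        (stripRep (FreeGroup.mk ((b, s) :: L))).val nilFun v = 0) ∧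
      ∀ v : List B, v.length = u.length + 1 → v.head? ≠ some b →
        (stripRep (FreeGroup.mk ((b, s) :: L))).val nilFun v = 0 := by
  classical
  induction L generalizing b s with
  | nil =>
    have e : ∀ v, (stripRep (FreeGroup.mk [(b, s)])).val nilFun v =
        nilFun v + letterSign s * stripOp b nilFun v := by
      intro v
      rw [stripRep_mk_cons]
      simp [← FreeGroup.one_eq_mk]
    refine ⟨[], 1, by simp, one_pos, ?_, ?_, ?_, ?_⟩
    · simp [e, stripOp_nil, nilFun]
    · simp [e, stripOp_nil, stripOp_cons, nilFun]
    · rintro (_ | ⟨a, _ | ⟨c, v⟩⟩) hv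
      · simp at hv
      · simp at hv
      · simp [e, stripOp_cons, nilFun]
    · rintro (_ | ⟨a, _ | ⟨c, v⟩⟩) hv hb
      · simp at hv
      · rw [e, stripOp_cons, if_neg (fun h => hb (by simp [h.1]))]
        simp [nilFun]
      · simp at hv
  | cons x L ih =>
    obtain ⟨a, r⟩ := x
    have hred := hL
    rw [FreeGroup.isReduced_cons_cons] at hred
    obtain ⟨u, m, hu, hm, h0, h1, h2, h3⟩ := ih a r hred.2
    set f := (stripRep (FreeGroup.mk ((a, r) :: L))).val nilFun with hf
    have e : ∀ v, (stripRep (FreeGroup.mk ((b, s) :: (a, r) :: L))).val nilFun v =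
        f v + letterSign s * stripOp b f v := by
      intro v
      rw [stripRep_mk_cons]
      simp [hf]
    have e' : ∀ v, v.head? ≠ some b →
        (stripRep (FreeGroup.mk ((b, s) :: (a, r) :: L))).val nilFun v = f v := by
      rintro (_ | ⟨c, v⟩) hv
      · simp [e, stripOp_nil]
      · rw [e, stripOp_cons, if_neg (fun h => hv (by simp [h.1]))]
        simp
    have e'' : ∀ v, v.head? ≠ some b →
        (stripRep (FreeGroup.mk ((b, s) :: (a, r) :: L))).val nilFun (b :: v) =
          f (b :: v) + letterSign s * f v := by
      intro v hv
      rw [e, stripOp_cons, if_pos ⟨rfl, hv⟩]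
    by_cases hab : b = a
    · subst hab
      have hs : s = r := hred.1 rfl
      subst hs
      refine ⟨u, m + 1, hu, by omega, by rwa [e' u hu], ?_, ?_, ?_⟩
      · rw [e'' u hu, e' u hu, h1]
        ring
      · rintro (_ | ⟨c, v⟩) hv
        · simp at hv
        · have hv' : u.length < v.length := by simpa using hv
          rw [e, h2 _ hv, stripOp_cons]
          split_ifs with h
          · rcases Nat.lt_or_ge (u.length + 1) v.length with hl | hl
            · rw [h2 v hl]; simp
            · rw [h3 v (by omega) h.2]; simp
          · simp
      · intro v hv hb
        rw [e' v hb, h3 v hv hb]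
    · have hu' : (a :: u).head? ≠ some b := by simpa using fun h => hab h.symm
      have hsign : letterSign r ≠ 0 := by cases r <;> simp [letterSign]
      have hz : f (b :: a :: u) = 0 := h2 _ (by simp)
      refine ⟨a :: u, 1, hu', one_pos, ?_, ?_, ?_, ?_⟩
      · rw [e' _ hu', h1]
        exact mul_ne_zero (mul_ne_zero hsign hm.ne') h0
      · rw [e'' _ hu', e' _ hu', hz]
        ring
      · rintro (_ | ⟨c, v⟩) hv
        · simp at hv
        · have hv' : u.length + 1 < v.length := by simpa using hv
          rw [e, h2 _ (by simp only [List.length_cons] at hv ⊢; omega), stripOp_cons, h2 v hv']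
          simp
      · intro v hv hb
        rw [e' v hb, h2 v (by simp only [List.length_cons] at hv ⊢; omega)]

theorem stripRep_nilFun_ne {k : FreeGroup B} (hk : k ≠ 1) :
    (stripRep k).val nilFun ≠ nilFun := by
  classical
  intro h
  rw [← FreeGroup.mk_toWord (x := k)] at h
  have hred := FreeGroup.isReduced_toWord (x := k)
  have hne : k.toWord ≠ [] := fun h => hk (FreeGroup.toWord_eq_nil_iff.1 h)
  generalize k.toWord = L at h hred hne
  rcases L with _ | ⟨⟨b, s⟩, L⟩
  · exact hne rfl
  · obtain ⟨u, m, -, hm, h0, h1, -⟩ := exists_strip_coeff_ne_zero b s L hred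
    -- `nilFun` vanishes at `b :: u`, whereas the formula in `h1` gives a nonzero value there.
    rw [h] at h0 h1
    have hsign : letterSign s ≠ 0 := by cases s <;> simp [letterSign]
    exact mul_ne_zero (mul_ne_zero hsign hm.ne') h0 (h1 ▸ rfl)

/-- Each `stripOp b` raises the order of vanishing by one, hence so does k - 1; the n-th power of
the augmentation ideal therefore kills all values on words of length below n. -/
theorem stripRep_sub_apply (k : FreeGroup B) {n : ℕ} {f : List B → ℤ}
    (hf : ∀ u : List B, u.length < n → f u = 0) (u : List B) (hu : u.length < n + 1) :
    (stripRep k).val f u = f u := by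
  classical
  have key : ∀ (b : B) (f : List B → ℤ), (∀ u : List B, u.length < n → f u = 0) →
      ∀ u : List B, u.length < n + 1 → stripOp b f u = 0 := by
    rintro b f hf (_ | ⟨a, v⟩) hu
    · rfl
    · rw [stripOp_cons]
      split_ifs
      · exact hf v (by simpa using hu)
      · rfl
  induction k using FreeGroup.induction_on generalizing f u with
  | C1 => simp
  | of b =>
    have : (stripRep (FreeGroup.of b)).val f u = f u + stripOp b f u := by
      simp [stripRep, stripUnit]
    rw [this, key b f hf u hu, add_zero]
  | inv_of b _ =>
    have : (stripRep (FreeGroup.of b)⁻¹).val f u = f u - stripOp b f u := by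
      simp [stripRep, stripUnit]
    rw [this, key b f hf u hu, sub_zero]
  | mul k l hk hl =>
    rw [map_mul, Units.val_mul, Module.End.mul_apply, hk _ u hu, hl hf u hu]
    intro v hv
    rw [hl hf v (by omega), hf v hv]

/-- A free group is residually nilpotent, in the form that the powers of the augmentation ideal
separate its elements. -/
theorem eq_one_of_forall_mem_augPow {k : FreeGroup B}
    (h : ∀ n, MonoidAlgebra.of ℤ _ k - 1 ∈ augPow (FreeGroup B) n) : k = 1 := by
  by_contra hk
  refine stripRep_nilFun_ne hk ?_
  let Φ : MonoidAlgebra ℤ (FreeGroup B) →ₐ[ℤ] Module.End ℤ (List B → ℤ) :=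
    MonoidAlgebra.lift ℤ _ _ ((Units.coeHom _).comp stripRep)
  have hΦ : ∀ l, Φ (MonoidAlgebra.of ℤ _ l) = (stripRep l).val := fun l => by simp [Φ]
  have key : ∀ n, ∀ x ∈ augPow (FreeGroup B) n, ∀ f : List B → ℤ, ∀ u : List B,
      u.length < n → Φ x f u = 0 := by
    intro n
    induction n with
    | zero => simp
    | succ n ih =>
      intro x hx f u hu
      let S : Submodule ℤ (MonoidAlgebra ℤ (FreeGroup B)) :=
        { carrier := {x | Φ x f u = 0}
          add_mem' := fun {a b} ha hb => by
            simp only [Set.mem_ofPred_eq] at ha hb ⊢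
            simp [ha, hb]
          zero_mem' := by simp
          smul_mem' := fun c a ha => by
            simp only [Set.mem_ofPred_eq] at ha ⊢
            simp [ha] }
      have : augPow (FreeGroup B) (n + 1) ≤ S := augPow_succ_le_of fun k x hx => by
        change Φ _ f u = 0
        rw [map_mul, map_sub, map_one, hΦ]
        change (stripRep k).val (Φ x f) u - Φ x f u = 0
        rw [stripRep_sub_apply k (fun v hv => ih x hx f v hv) u hu, sub_self]
      exact this hx
  funext u
  have := key (u.length + 1) _ (h _) nilFun u (Nat.lt_succ_self _)
  rw [map_sub, map_one, hΦ] at this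
  exact sub_eq_zero.1 this

end Residual

/-! ### Unitriangular representations and the leading-term functional. -/

section Triangular

variable {B : Type*} (ι : ℕ → B → ℝ)

/-- The weighted shift `f ↦ (0, ι 0 b * f 0, ι 1 b * f 1, …)` on sequences. -/
noncomputable def shiftOp (b : B) : Module.End ℤ (ℕ → ℝ) where
  toFun f n := match n with
    | 0 => 0
    | n + 1 => ι n b * f n
  map_add' f g := by
    funext n
    cases n with
    | zero => simp
    | succ n => simp [mul_add]
  map_smul' c f := by
    funext n
    cases n with
    | zero => simp
    | succ n => simp; ring

theorem shiftOp_zero (b : B) (f : ℕ → ℝ) : shiftOp ι b f 0 = 0 := rfl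

theorem shiftOp_succ (b : B) (f : ℕ → ℝ) (n : ℕ) : shiftOp ι b f (n + 1) = ι n b * f n := rfl

/-- The preimage of a sequence under `1 + shiftOp ι b`. -/
noncomputable def shiftInv (b : B) (f : ℕ → ℝ) : ℕ → ℝ
  | 0 => f 0
  | n + 1 => f (n + 1) - ι n b * shiftInv b f n

/-- The unipotent operator `1 + shiftOp ι b`, as an automorphism. -/
noncomputable def shiftEquiv (b : B) : (ℕ → ℝ) ≃ₗ[ℤ] (ℕ → ℝ) :=
  { (1 + shiftOp ι b : Module.End ℤ (ℕ → ℝ)) with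
    invFun := shiftInv ι b
    left_inv := fun f => by
      funext n
      induction n with
      | zero => simp [shiftInv, shiftOp_zero]
      | succ n ih =>
        rw [shiftInv, ih]
        simp [shiftOp_succ]
    right_inv := fun f => by
      funext n
      cases n with
      | zero => simp [shiftInv, shiftOp_zero]
      | succ n => simp [shiftInv, shiftOp_succ] }

theorem shiftEquiv_zero (b : B) (f : ℕ → ℝ) : shiftEquiv ι b f 0 = f 0 := by
  change f 0 + shiftOp ι b f 0 = _
  rw [shiftOp_zero, add_zero]

theorem shiftEquiv_succ (b : B) (f : ℕ → ℝ) (n : ℕ) :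
    shiftEquiv ι b f (n + 1) = f (n + 1) + ι n b * f n := rfl

/-- The lower unitriangular representation of a free group whose subdiagonal entries on a
generator `b` are the numbers `ι n b`. -/
noncomputable def triRep : FreeGroup B →* ((ℕ → ℝ) ≃ₗ[ℤ] (ℕ → ℝ)) :=
  FreeGroup.lift (shiftEquiv ι)

/-- The additive character of a free group with prescribed values on the generators. -/
noncomputable def addChar (p : B → ℝ) (k : FreeGroup B) : ℝ :=
  Multiplicative.toAdd (FreeGroup.lift (fun b => Multiplicative.ofAdd (p b)) k)

@[simp] theorem addChar_one (p : B → ℝ) : addChar p 1 = 0 := by simp [addChar]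

@[simp] theorem addChar_of (p : B → ℝ) (b : B) : addChar p (FreeGroup.of b) = p b := by
  simp [addChar]

@[simp] theorem addChar_mul (p : B → ℝ) (k l : FreeGroup B) :
    addChar p (k * l) = addChar p k + addChar p l := by simp [addChar]

@[simp] theorem addChar_inv (p : B → ℝ) (k : FreeGroup B) :
    addChar p k⁻¹ = - addChar p k := by simp [addChar]

theorem triRep_apply (k : FreeGroup B) {m : ℕ} {f : ℕ → ℝ} (hf : ∀ j < m, f j = 0) :
    (∀ j ≤ m, triRep ι k f j = f j) ∧
      triRep ι k f (m + 1) = f (m + 1) + addChar (ι m) k * f m := by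
  induction k using FreeGroup.induction_on generalizing f with
  | C1 => simp
  | of b =>
    simp only [triRep, FreeGroup.lift_apply_of, addChar_of]
    refine ⟨?_, shiftEquiv_succ ι b f m⟩
    rintro (_ | j) hj
    · exact shiftEquiv_zero ι b f
    · rw [shiftEquiv_succ, hf j (by omega), mul_zero, add_zero]
  | inv_of b h =>
    -- Instead of expanding the inverse, its entries are solved for one by one from (1 + shift) g =
    -- f.
    set g := triRep ι (FreeGroup.of b)⁻¹ f with hg
    have hgf : triRep ι (FreeGroup.of b) g = f := by
      rw [hg, ← LinearEquiv.mul_apply, ← map_mul, mul_inv_cancel, map_one]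
      rfl
    have hsucc : ∀ j, f (j + 1) = g (j + 1) + ι j b * g j := by
      intro j
      rw [← hgf, triRep, FreeGroup.lift_apply_of]
      exact shiftEquiv_succ ι b g j
    have hzero : f 0 = g 0 := by
      rw [← hgf, triRep, FreeGroup.lift_apply_of]
      exact shiftEquiv_zero ι b g
    have hlow : ∀ j ≤ m, g j = f j := by
      intro j
      induction j with
      | zero => intro; exact hzero.symm
      | succ j ih =>
        intro hj
        rw [hsucc j, ih (by omega), hf j (by omega), mul_zero, add_zero]
    refine ⟨hlow, ?_⟩
    rw [hsucc m, hlow m le_rfl, addChar_inv, addChar_of]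
    ring
  | mul k l hk hl =>
    obtain ⟨h1, h2⟩ := hl hf
    obtain ⟨h3, h4⟩ := hk (f := triRep ι l f) fun j hj => by rw [h1 j hj.le, hf j hj]
    rw [map_mul]
    refine ⟨fun j hj => ?_, ?_⟩
    · rw [LinearEquiv.mul_apply, h3 j hj, h1 j hj]
    · rw [LinearEquiv.mul_apply, h4, h2, h1 m le_rfl, addChar_mul]
      ring

/-- The action of the group ring on sequences through `triRep`. -/
noncomputable def triAlg : MonoidAlgebra ℤ (FreeGroup B) →ₐ[ℤ] Module.End ℤ (ℕ → ℝ) :=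
  MonoidAlgebra.lift ℤ _ _
    ((LinearEquiv.automorphismGroup.toLinearMapMonoidHom).comp (triRep ι))

theorem triAlg_of (k : FreeGroup B) (f : ℕ → ℝ) :
    triAlg ι (MonoidAlgebra.of ℤ _ k) f = triRep ι k f := by
  simp [triAlg]

theorem triAlg_sub_one_mul (k : FreeGroup B) (x : MonoidAlgebra ℤ (FreeGroup B)) (f : ℕ → ℝ) :
    triAlg ι ((MonoidAlgebra.of ℤ _ k - 1) * x) f =
      triRep ι k (triAlg ι x f) - triAlg ι x f := by
  rw [map_mul, map_sub, map_one, Module.End.mul_apply, LinearMap.sub_apply, triAlg_of]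
  rfl

/-- The matrix entry in row `n` and column `0` of the representation `triAlg`. -/
noncomputable def corner (n : ℕ) : MonoidAlgebra ℤ (FreeGroup B) →ₗ[ℤ] ℝ :=
  (LinearMap.proj n).comp ((LinearMap.applyₗ (Pi.single 0 1)).comp (triAlg ι).toLinearMap)

theorem corner_apply (n : ℕ) (x : MonoidAlgebra ℤ (FreeGroup B)) :
    corner ι n x = triAlg ι x (Pi.single 0 1) n := rfl

theorem corner_eq_zero_of_lt {m n : ℕ} {x : MonoidAlgebra ℤ (FreeGroup B)}
    (hx : x ∈ augPow (FreeGroup B) n) (hmn : m < n) : corner ι m x = 0 := by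
  induction n generalizing m x with
  | zero => omega
  | succ n ih =>
    have : augPow (FreeGroup B) (n + 1) ≤ LinearMap.ker (corner ι m) :=
      augPow_succ_le_of fun k x hx => by
        rw [LinearMap.mem_ker, corner_apply, triAlg_sub_one_mul, Pi.sub_apply, sub_eq_zero]
        exact (triRep_apply ι k (m := n) fun j hj => ih hx hj).1 m (by omega)
    exact this hx

theorem corner_sub_one_mul {n : ℕ} (k : FreeGroup B) {x : MonoidAlgebra ℤ (FreeGroup B)}
    (hx : x ∈ augPow (FreeGroup B) n) :
    corner ι (n + 1) ((MonoidAlgebra.of ℤ _ k - 1) * x) = addChar (ι n) k * corner ι n x := by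
  rw [corner_apply, triAlg_sub_one_mul, Pi.sub_apply,
    (triRep_apply ι k (f := triAlg ι x (Pi.single 0 1)) (m := n)
      fun j hj => corner_eq_zero_of_lt ι hx hj).2, corner_apply]
  ring

theorem corner_zero_of (k : FreeGroup B) : corner ι 0 (MonoidAlgebra.of ℤ _ k) = 1 := by
  rw [corner_apply, triAlg_of, (triRep_apply ι k (m := 0) (by simp)).1 0 le_rfl]
  simp

/-- At level n the functional is a product of one character from each level below n, so the factors
multiply; level 0 is the augmentation, which is unchanged. -/
theorem corner_map {ψ : FreeGroup B →* FreeGroup B} {c : ℕ → ℝ}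
    (hc : ∀ n k, addChar (ι n) (ψ k) = c n * addChar (ι n) k) {n : ℕ}
    {x : MonoidAlgebra ℤ (FreeGroup B)} (hx : x ∈ augPow (FreeGroup B) n) :
    corner ι n (groupRingMap ψ x) = (∏ i ∈ Finset.range n, c i) * corner ι n x := by
  induction n generalizing x with
  | zero =>
    induction x using MonoidAlgebra.induction_on with
    | of k => rw [groupRingMap_of, corner_zero_of, corner_zero_of]; simp
    | add a b ha hb => rw [map_add, map_add, map_add, ha trivial, hb trivial, mul_add]
    | smul r a ha => rw [map_smul, map_smul, map_smul, ha trivial, mul_smul_comm]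
  | succ n ih =>
    have : augPow (FreeGroup B) (n + 1) ≤ LinearMap.eqLocus
        ((corner ι (n + 1)).comp (groupRingMap ψ).toLinearMap)
        ((LinearMap.mulLeft ℤ (∏ i ∈ Finset.range (n + 1), c i)).comp (corner ι (n + 1))) :=
      augPow_succ_le_of fun k x hx => by
        simp only [LinearMap.mem_eqLocus, LinearMap.comp_apply, AlgHom.toLinearMap_apply,
          LinearMap.mulLeft_apply, map_mul, map_sub, map_one, groupRingMap_of]
        rw [corner_sub_one_mul ι _ (groupRingMap_mem_augPow ψ hx), corner_sub_one_mul ι _ hx,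
          ih hx, hc, Finset.prod_range_succ]
        ring
    exact this hx

/-- Elements of `augPow _ (n + 1)` are combinations of the elements `b - 1`, modulo
`augPow _ (n + 2)`. -/
theorem exists_finsupp_of_mem_augPow {n : ℕ} {x : MonoidAlgebra ℤ (FreeGroup B)}
    (hx : x ∈ augPow (FreeGroup B) (n + 1)) :
    ∃ c : B →₀ MonoidAlgebra ℤ (FreeGroup B), (∀ b, c b ∈ augPow (FreeGroup B) n) ∧
      x - c.sum (fun b y => (MonoidAlgebra.of ℤ _ (FreeGroup.of b) - 1) * y) ∈
        augPow (FreeGroup B) (n + 2) := by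
  classical
  let σ : (B →₀ MonoidAlgebra ℤ (FreeGroup B)) →ₗ[ℤ] MonoidAlgebra ℤ (FreeGroup B) :=
    Finsupp.lsum ℤ fun b =>
      LinearMap.mulLeft ℤ (MonoidAlgebra.of ℤ _ (FreeGroup.of b) - 1)
  let C : Submodule ℤ (B →₀ MonoidAlgebra ℤ (FreeGroup B)) :=
    { carrier := {c | ∀ b, c b ∈ augPow (FreeGroup B) n}
      add_mem' := fun ha hb b => add_mem (ha b) (hb b)
      zero_mem' := fun b => zero_mem _
      smul_mem' := fun r a ha b => Submodule.smul_mem _ r (ha b) }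
  let S := C.map σ ⊔ augPow (FreeGroup B) (n + 2)
  have hS : augPow (FreeGroup B) (n + 2) ≤ S := le_sup_right
  -- Modulo `augPow _ (n + 2)` the map k ↦ (k - 1)x is additive in k, so generators suffice.
  have key : ∀ k : FreeGroup B, ∀ x ∈ augPow (FreeGroup B) n,
      (MonoidAlgebra.of ℤ _ k - 1) * x ∈ S := by
    intro k
    induction k using FreeGroup.induction_on with
    | C1 => intro x _; rw [map_one, sub_self, zero_mul]; exact zero_mem _
    | of b =>
      intro x hx
      refine Submodule.mem_sup_left ⟨Finsupp.single b x, fun b' => ?_, ?_⟩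
      · rw [Finsupp.single_apply]
        split_ifs
        · exact hx
        · exact zero_mem _
      · simp [σ]
    | inv_of b h =>
      intro x hx
      have e : (MonoidAlgebra.of ℤ (FreeGroup B) (FreeGroup.of b)⁻¹ - 1) * x =
          -((MonoidAlgebra.of ℤ _ (FreeGroup.of b) - 1) * x) -
          (MonoidAlgebra.of ℤ _ (FreeGroup.of b)⁻¹ - 1) *
            ((MonoidAlgebra.of ℤ _ (FreeGroup.of b) - 1) * x) := by
        have h1 : MonoidAlgebra.of ℤ (FreeGroup B) (FreeGroup.of b)⁻¹ *
            MonoidAlgebra.of ℤ _ (FreeGroup.of b) = 1 := by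
          rw [← map_mul, inv_mul_cancel, map_one]
        simp only [sub_mul, mul_sub, ← mul_assoc, h1, one_mul]
        abel
      rw [e]
      exact sub_mem (neg_mem (h x hx))
        (hS (sub_one_mul_mem_augPow _ (sub_one_mul_mem_augPow _ hx)))
    | mul k l hk hl =>
      intro x hx
      have e : (MonoidAlgebra.of ℤ (FreeGroup B) (k * l) - 1) * x =
          (MonoidAlgebra.of ℤ _ k - 1) * ((MonoidAlgebra.of ℤ _ l - 1) * x) +
          (MonoidAlgebra.of ℤ _ k - 1) * x + (MonoidAlgebra.of ℤ _ l - 1) * x := by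
        rw [map_mul]
        noncomm_ring
      rw [e]
      exact add_mem (add_mem
        (hS (sub_one_mul_mem_augPow _ (sub_one_mul_mem_augPow _ hx))) (hk x hx)) (hl x hx)
  obtain ⟨_, ⟨c, hc, rfl⟩, z, hz, rfl⟩ := Submodule.mem_sup.1 (augPow_succ_le_of key hx)
  refine ⟨c, hc, ?_⟩
  have : σ c = c.sum (fun b y => (MonoidAlgebra.of ℤ _ (FreeGroup.of b) - 1) * y) := by
    rfl
  rw [this, add_sub_cancel_left]
  exact hz

variable {ι} {E : ℕ → Subfield ℝ}

/-- On `augPow _ n` only the families below level n enter. The values can thus serve as coefficients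
against `ι n`, which is independent over `E n`. -/
theorem corner_mem (hE : ∀ n, E n ≤ E (n + 1)) (hι : ∀ n b, ι n b ∈ E (n + 1)) {n : ℕ}
    {x : MonoidAlgebra ℤ (FreeGroup B)} (hx : x ∈ augPow (FreeGroup B) n) :
    corner ι n x ∈ E n := by
  induction n generalizing x with
  | zero =>
    induction x using MonoidAlgebra.induction_on with
    | of k => rw [corner_zero_of]; exact one_mem _
    | add a b ha hb => rw [map_add]; exact add_mem (ha trivial) (hb trivial)
    | smul r a ha => rw [map_smul]; exact zsmul_mem (ha trivial) r
  | succ n ih =>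
    have hchar : ∀ k, addChar (ι n) k ∈ E (n + 1) := by
      intro k
      induction k using FreeGroup.induction_on with
      | C1 => simp
      | of b => simpa using hι n b
      | inv_of b _ => simpa using hι n b
      | mul k l hk hl => rw [addChar_mul]; exact add_mem hk hl
    let S : Submodule ℤ (MonoidAlgebra ℤ (FreeGroup B)) :=
      ((E (n + 1)).toSubring.toAddSubgroup.toIntSubmodule).comap (corner ι (n + 1))
    have : augPow (FreeGroup B) (n + 1) ≤ S := augPow_succ_le_of fun k x hx => by
      change corner ι (n + 1) _ ∈ E (n + 1)
      rw [corner_sub_one_mul ι k hx]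
      exact mul_mem (hchar k) (hE n (ih hx))
    exact this hx

/-- Write x as Σ (b - 1)c_b up to higher order. Its corner is Σ ι n b · corner(c_b), so independence
kills every corner(c_b), and induction puts each c_b one power deeper. At level 0, x is an integer
modulo the augmentation ideal and the corner is that integer. -/
theorem mem_augPow_succ_of_corner_eq_zero (hE : ∀ n, E n ≤ E (n + 1))
    (hι : ∀ n b, ι n b ∈ E (n + 1)) (hind : ∀ n, LinearIndependent (E n) (ι n)) {n : ℕ}
    {x : MonoidAlgebra ℤ (FreeGroup B)} (hx : x ∈ augPow (FreeGroup B) n)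
    (h0 : corner ι n x = 0) : x ∈ augPow (FreeGroup B) (n + 1) := by
  induction n generalizing x with
  | zero =>
    have key : ∀ y : MonoidAlgebra ℤ (FreeGroup B),
        ∃ r : ℤ, y - algebraMap ℤ _ r ∈ augPow (FreeGroup B) 1 := by
      intro y
      induction y using MonoidAlgebra.induction_on with
      | of k => exact ⟨1, by rw [map_one]; exact sub_one_mem_augPow_one k⟩
      | add a b ha hb =>
        obtain ⟨r, hr⟩ := ha
        obtain ⟨s, hs⟩ := hb
        exact ⟨r + s, by rw [map_add, add_sub_add_comm]; exact add_mem hr hs⟩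
      | smul r a ha =>
        obtain ⟨s, hs⟩ := ha
        refine ⟨r * s, ?_⟩
        have := Submodule.smul_mem _ r hs
        rwa [smul_sub, ← map_zsmul, smul_eq_mul] at this
    obtain ⟨r, hr⟩ := key x
    have h1 := corner_eq_zero_of_lt ι hr zero_lt_one
    rw [map_sub, h0, Algebra.algebraMap_eq_smul_one, map_smul,
      ← map_one (MonoidAlgebra.of ℤ (FreeGroup B)), corner_zero_of] at h1
    have : r = 0 := by simpa using h1
    simpa [this] using hr
  | succ n ih =>
    obtain ⟨c, hc, hxc⟩ := exists_finsupp_of_mem_augPow hx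
    have h1 := corner_eq_zero_of_lt ι hxc (Nat.lt_succ_self _)
    rw [map_sub, h0, zero_sub, neg_eq_zero, Finsupp.sum, map_sum] at h1
    have h2 : ∑ b ∈ c.support,
        (⟨corner ι n (c b), corner_mem hE hι (hc b)⟩ : E n) • ι n b = 0 := by
      rw [← h1]
      refine Finset.sum_congr rfl fun b _ => ?_
      rw [corner_sub_one_mul ι _ (hc b), addChar_of, mul_comm]
      rfl
    have h3 := linearIndependent_iff'.1 (hind n) c.support _ h2
    have h4 : c.sum (fun b y => (MonoidAlgebra.of ℤ _ (FreeGroup.of b) - 1) * y) ∈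
        augPow (FreeGroup B) (n + 2) :=
      Submodule.sum_mem _ fun b hb => sub_one_mul_mem_augPow _ <|
        ih (hc b) (by simpa using congrArg Subtype.val (h3 b hb))
    simpa using add_mem hxc h4

theorem exists_pos_level (hE : ∀ n, E n ≤ E (n + 1))
    (hι : ∀ n b, ι n b ∈ E (n + 1)) (hind : ∀ n, LinearIndependent (E n) (ι n))
    {k : FreeGroup B} (hk : k ≠ 1) :
    ∃ n, MonoidAlgebra.of ℤ _ k - 1 ∈ augPow (FreeGroup B) n ∧
      corner ι n (MonoidAlgebra.of ℤ _ k - 1) ≠ 0 := by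
  by_contra! h
  refine hk (eq_one_of_forall_mem_augPow fun n => ?_)
  induction n with
  | zero => trivial
  | succ n ih => exact mem_augPow_succ_of_corner_eq_zero hE hι hind ih (h n ih)

/-! ### The positive cone of leading terms. -/

variable (ι) in
/-- The elements of a free group whose leading term has positive `corner`. -/
def posCone : Set (FreeGroup B) :=
  {k | ∃ n, MonoidAlgebra.of ℤ _ k - 1 ∈ augPow (FreeGroup B) n ∧
    0 < corner ι n (MonoidAlgebra.of ℤ _ k - 1)}

theorem one_notMem_posCone : (1 : FreeGroup B) ∉ posCone ι := by
  rintro ⟨n, -, h⟩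
  simp only [map_one, sub_self, map_zero, lt_irrefl] at h

/-- In kl - 1 = (k - 1)(l - 1) + (k - 1) + (l - 1) the product lies one power deeper. -/
theorem corner_mul_sub_one {k l : FreeGroup B} {n : ℕ}
    (hk : MonoidAlgebra.of ℤ _ k - 1 ∈ augPow (FreeGroup B) n)
    (hl : MonoidAlgebra.of ℤ _ l - 1 ∈ augPow (FreeGroup B) n) :
    MonoidAlgebra.of ℤ _ (k * l) - 1 ∈ augPow (FreeGroup B) n ∧
      corner ι n (MonoidAlgebra.of ℤ _ (k * l) - 1) =
        corner ι n (MonoidAlgebra.of ℤ _ k - 1) + corner ι n (MonoidAlgebra.of ℤ _ l - 1) := by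
  have e : MonoidAlgebra.of ℤ (FreeGroup B) (k * l) - 1 =
      (MonoidAlgebra.of ℤ _ k - 1) * (MonoidAlgebra.of ℤ _ l - 1) +
      (MonoidAlgebra.of ℤ _ k - 1) + (MonoidAlgebra.of ℤ _ l - 1) := by
    rw [map_mul]
    noncomm_ring
  have h := sub_one_mul_mem_augPow k hl
  rw [e]
  refine ⟨add_mem (add_mem (augPow_succ_le _ h) hk) hl, ?_⟩
  rw [map_add, map_add, corner_eq_zero_of_lt ι h (Nat.lt_succ_self _), zero_add]

theorem mul_mem_posCone {k l : FreeGroup B} (hk : k ∈ posCone ι) (hl : l ∈ posCone ι) :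
    k * l ∈ posCone ι := by
  obtain ⟨n, hn, hn'⟩ := hk
  obtain ⟨m, hm, hm'⟩ := hl
  rcases lt_trichotomy n m with h | rfl | h
  · have hm2 := augPow_antitone h.le hm
    obtain ⟨h1, h2⟩ := corner_mul_sub_one (ι := ι) hn hm2
    refine ⟨n, h1, ?_⟩
    rwa [h2, corner_eq_zero_of_lt ι hm h, add_zero]
  · obtain ⟨h1, h2⟩ := corner_mul_sub_one (ι := ι) hn hm
    exact ⟨n, h1, h2 ▸ add_pos hn' hm'⟩
  · have hn2 := augPow_antitone h.le hn
    obtain ⟨h1, h2⟩ := corner_mul_sub_one (ι := ι) hn2 hm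
    refine ⟨m, h1, ?_⟩
    rwa [h2, corner_eq_zero_of_lt ι hn h, zero_add]

theorem map_mem_posCone {ψ : FreeGroup B →* FreeGroup B}
    (hψ : ∀ n, ∃ c : ℝ, 0 < c ∧ ∀ k, addChar (ι n) (ψ k) = c * addChar (ι n) k)
    {k : FreeGroup B} (hk : k ∈ posCone ι) : ψ k ∈ posCone ι := by
  choose c hc hψ using hψ
  obtain ⟨n, hn, hn'⟩ := hk
  have e : MonoidAlgebra.of ℤ (FreeGroup B) (ψ k) - 1 =
      groupRingMap ψ (MonoidAlgebra.of ℤ _ k - 1) := by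
    rw [map_sub, map_one, groupRingMap_of]
  refine ⟨n, ?_, ?_⟩
  · rw [e]
    exact groupRingMap_mem_augPow ψ hn
  · rw [e, corner_map ι hψ hn]
    exact mul_pos (Finset.prod_pos fun i _ => hc i) hn'

/-- Characters are invariant under conjugation, so all scaling factors are 1. -/
theorem conj_mem_posCone {k : FreeGroup B} (hk : k ∈ posCone ι) (l : FreeGroup B) :
    l * k * l⁻¹ ∈ posCone ι :=
  map_mem_posCone (ψ := (MulAut.conj l).toMonoidHom)
    (fun n => ⟨1, one_pos, fun k => by simp⟩) hk

theorem mem_or_inv_mem_posCone (hE : ∀ n, E n ≤ E (n + 1))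
    (hι : ∀ n b, ι n b ∈ E (n + 1)) (hind : ∀ n, LinearIndependent (E n) (ι n))
    {k : FreeGroup B} (hk : k ≠ 1) : k ∈ posCone ι ∨ k⁻¹ ∈ posCone ι := by
  obtain ⟨n, hn, hn'⟩ := exists_pos_level hE hι hind hk
  rcases lt_or_gt_of_ne hn' with h | h
  · right
    have hinv : MonoidAlgebra.of ℤ (FreeGroup B) k⁻¹ - 1 ∈ augPow (FreeGroup B) n := by
      have : MonoidAlgebra.of ℤ (FreeGroup B) k⁻¹ - 1 =
          -(MonoidAlgebra.of ℤ _ k⁻¹ * (MonoidAlgebra.of ℤ _ k - 1)) := by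
        rw [mul_sub, ← map_mul, inv_mul_cancel, map_one, mul_one, neg_sub]
      rw [this]
      exact neg_mem (of_mul_mem_augPow hn _)
    have h2 := (corner_mul_sub_one (ι := ι) hn hinv).2
    rw [mul_inv_cancel, map_one, sub_self, map_zero] at h2
    exact ⟨n, hinv, by linarith⟩
  · exact Or.inl ⟨n, hn, h⟩

end Triangular

/-! ### Positive cones and order-preserving automorphisms of general groups. -/

/-- A bi-ordering from a positive cone. -/
theorem isBiOrdering_of_cone {G : Type*} [Group G] {P : Set G} (h1 : (1 : G) ∉ P)
    (hmul : ∀ g ∈ P, ∀ h ∈ P, g * h ∈ P) (hconj : ∀ g ∈ P, ∀ h, h * g * h⁻¹ ∈ P)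
    (htot : ∀ g, g ≠ 1 → g ∈ P ∨ g⁻¹ ∈ P) : IsBiOrdering fun f g : G => f⁻¹ * g ∈ P where
  strictTotal :=
    { trichotomous := fun f g hfg hgf => by
        by_contra hne
        rcases htot (f⁻¹ * g) (fun h => hne (inv_mul_eq_one.1 h)) with h | h
        · exact hfg h
        · exact hgf (by simpa using h)
      irrefl := fun f h => h1 (by simpa using h)
      trans := fun f g k hfg hgk => by simpa [mul_assoc] using hmul _ hfg _ hgk }
  mul_left := fun f g h hfg => by simpa [mul_assoc] using hfg
  mul_right := fun f g h hfg => by simpa [mul_assoc] using hconj _ hfg h⁻¹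

/-- An automorphism mapping a positive cone into itself preserves the associated bi-ordering. -/
theorem isOrderPreservingAut_of_cone {G : Type*} [Group G] {P : Set G} (h1 : (1 : G) ∉ P)
    (hmul : ∀ g ∈ P, ∀ h ∈ P, g * h ∈ P) (hconj : ∀ g ∈ P, ∀ h, h * g * h⁻¹ ∈ P)
    (htot : ∀ g, g ≠ 1 → g ∈ P ∨ g⁻¹ ∈ P) (φ : MulAut G) (hφ : ∀ g ∈ P, φ g ∈ P) :
    IsOrderPreservingAut φ := by
  refine ⟨_, isBiOrdering_of_cone h1 hmul hconj htot, fun f g => ⟨fun h => ?_, fun h => ?_⟩⟩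
  · simpa using hφ _ h
  · rw [← map_inv, ← map_mul] at h
    by_contra hn
    by_cases he : f⁻¹ * g = 1
    · rw [he, map_one] at h
      exact h1 h
    · have h2 := hφ _ ((htot _ he).resolve_left hn)
      have h3 := hmul _ h _ h2
      rw [← map_mul, mul_inv_cancel, map_one] at h3
      exact h1 h3

/-- Order preservation is invariant under isomorphism. -/
theorem IsOrderPreservingAut.of_mulEquiv {G H : Type*} [Group G] [Group H] (e : G ≃* H)
    {φ : MulAut G} {ψ : MulAut H} (h : ∀ g, e (φ g) = ψ (e g)) (hψ : IsOrderPreservingAut ψ) :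
    IsOrderPreservingAut φ := by
  obtain ⟨lt, hlt, hpres⟩ := hψ
  refine ⟨fun f g => lt (e f) (e g), ⟨?_, ?_, ?_⟩, fun f g => ?_⟩
  · exact
      { trichotomous := fun f g hfg hgf =>
          e.injective (hlt.strictTotal.trichotomous _ _ hfg hgf)
        irrefl := fun f => hlt.strictTotal.irrefl _
        trans := fun f g k => hlt.strictTotal.trans _ _ _ }
  · intro f g k hfg
    simpa using hlt.mul_left _ _ (e k) hfg
  · intro f g k hfg
    simpa using hlt.mul_right _ _ (e k) hfg
  · simp only [h]
    exact hpres _ _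

/-! ### Transcendental parameters, irrational eigenvalues and independence. -/

section Fields

theorem countable_subfield_closure {s : Set ℝ} (hs : s.Countable) :
    Countable (Subfield.closure s) := by
  rw [← Cardinal.mk_le_aleph0_iff]
  exact (Subfield.cardinalMk_closure_le_max s).trans (max_le hs.le_aleph0 le_rfl)

/-- Iterated choice of a linearly independent family over growing countable subfields of `ℝ`. -/
theorem exists_independent_tower {B : Type*} [Countable B] (Q : (B → ℝ) → Prop)
    (h : ∀ E : Subfield ℝ, Countable E → ∃ ι : B → ℝ, Q ι ∧ LinearIndependent E ι) :
    ∃ (E : ℕ → Subfield ℝ) (ι : ℕ → B → ℝ), (∀ n, E n ≤ E (n + 1)) ∧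
      (∀ n b, ι n b ∈ E (n + 1)) ∧ (∀ n, LinearIndependent (E n) (ι n)) ∧ ∀ n, Q (ι n) := by
  choose! ι hQ hι using h
  -- Adjoining a countable family keeps the field countable, so the choice can be repeated.
  let next : {E : Subfield ℝ // Countable E} → {E : Subfield ℝ // Countable E} := fun E =>
    ⟨Subfield.closure ((E.1 : Set ℝ) ∪ Set.range (ι E.1)), countable_subfield_closure <|
      (Set.countable_coe_iff.1 E.2).union (Set.countable_range _)⟩
  let E : ℕ → {E : Subfield ℝ // Countable E} := fun n => Nat.rec
    ⟨Subfield.closure ∅, countable_subfield_closure Set.countable_empty⟩ (fun _ => next) n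
  refine ⟨fun n => (E n).1, fun n => ι (E n).1, fun n => ?_, fun n b => ?_,
    fun n => hι _ (E n).2, fun n => hQ _ (E n).2⟩
  · exact fun x hx => Subfield.subset_closure (Or.inl hx)
  · exact Subfield.subset_closure (Or.inr ⟨b, rfl⟩)

theorem exists_pos_transcendental (E : Subfield ℝ) (hE : Countable E) :
    ∃ t : ℝ, 0 < t ∧ Transcendental E t := by
  by_contra! h
  refine Cardinal.not_countable_real ?_
  have h1 : (Set.Ioi (0 : ℝ)).Countable := (Algebraic.countable E ℝ).mono fun t ht => by
    by_contra hn
    exact h t ht hn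
  exact absurd h1 (by
    rw [← Cardinal.le_aleph0_iff_set_countable, Cardinal.mk_Ioi_real, not_le]
    exact Cardinal.aleph0_lt_continuum)

open Polynomial in
/-- If `f ^ 2 + 4 X ^ m` is a square for some odd `m`, then `f = ± (X ^ i - X ^ j)` with `i + j`
odd; in particular `f (-1) = ± 2`. -/
theorem sq_eval_neg_one_of_sq_eq {E : Type*} [Field E] [CharZero E] {f : ℤ[X]} {m : ℕ}
    (hm : Odd m) {Y : E[X]} (h : Y ^ 2 = f.map (Int.castRingHom E) ^ 2 + 4 * X ^ m) :
    f.eval (-1) ^ 2 = 4 := by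
  set F := f.map (Int.castRingHom E) with hF
  have h4 : (4 : E[X]) = C 4 := rfl
  have hfac : (Y - F) * (Y + F) = C 4 * X ^ m := by rw [← h4]; linear_combination h
  have hdvd : Y - F ∣ X ^ m := ⟨C (4⁻¹) * (Y + F), by
    rw [mul_left_comm, hfac, ← mul_assoc, ← C_mul]
    simp⟩
  obtain ⟨j, hj, hass⟩ := (dvd_prime_pow prime_X m).1 hdvd
  -- Since X is prime, Y - F and Y + F are monomials up to units, with exponents summing to the odd
  -- number m and hence distinct.
  obtain ⟨v, hv⟩ := hass.symm
  obtain ⟨u, hu, huv⟩ := Polynomial.isUnit_iff.1 v.isUnit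
  have hu0 : u ≠ 0 := hu.ne_zero
  have h1 : Y - F = C u * X ^ j := by rw [huv, mul_comm, hv]
  obtain ⟨i, rfl⟩ := Nat.exists_eq_add_of_le hj
  have h2 : Y + F = C (4 / u) * X ^ i := by
    have hne : C u * X ^ j ≠ (0 : E[X]) := mul_ne_zero (by simpa using hu0) (by simp)
    refine mul_left_cancel₀ hne ?_
    rw [← h1, hfac, h1, pow_add]
    have : C u * C (4 / u) = (C 4 : E[X]) := by rw [← C_mul, mul_div_cancel₀ _ hu0]
    linear_combination -(X ^ j * X ^ i) * this
  have h3 : 2 * F = C (4 / u) * X ^ i - C u * X ^ j := by linear_combination h2 - h1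
  have hij : i ≠ j := by
    rintro rfl
    exact (Nat.not_even_iff_odd.2 hm) ⟨i, rfl⟩
  have hcoeff : ∀ k, 2 * (f.coeff k : E) =
      (if k = i then 4 / u else 0) - (if k = j then u else 0) := by
    intro k
    have := congrArg (fun p => coeff p k) h3
    simpa [hF, coeff_X_pow, ← C_ofNat, coeff_C_mul] using this
  have hi := hcoeff i
  have hj' := hcoeff j
  rw [if_pos rfl, if_neg hij, sub_zero] at hi
  rw [if_pos rfl, if_neg hij.symm, zero_sub] at hj'
  -- The coefficients 2/u and -u/2 multiply to -1; being integers, they are ±1.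
  have hprod : f.coeff i * f.coeff j = -1 := by
    have : (f.coeff i : E) * f.coeff j = -1 := by
      have h5 : (2 * (f.coeff i : E)) * (2 * f.coeff j) = -4 := by
        rw [hi, hj']
        field_simp
      linear_combination h5 / 4
    exact_mod_cast this
  have hf : f = C (f.coeff i) * X ^ i + C (f.coeff j) * X ^ j := by
    ext k
    by_cases hki : k = i
    · subst hki
      simp [coeff_X_pow, hij]
    · by_cases hkj : k = j
      · subst hkj
        simp [coeff_X_pow, hki]
      · have := hcoeff k
        rw [if_neg hki, if_neg hkj, sub_zero] at this
        have h0 : f.coeff k = 0 := by simpa using this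
        simp [coeff_X_pow, hki, hkj, h0]
  have hsign : (-1 : ℤ) ^ j * (-1) ^ i = -1 := by rw [← pow_add]; exact hm.neg_one_pow
  have hsq : ∀ k : ℕ, ((-1 : ℤ) ^ k) ^ 2 = 1 := fun k => by rw [← pow_mul, mul_comm, pow_mul]; simp
  rw [hf]
  simp only [eval_add, eval_mul, eval_C, eval_pow, eval_X]
  rcases Int.isUnit_iff.1 (IsUnit.of_mul_eq_one (a := f.coeff i) (-f.coeff j) (by linarith)) with h6 | h6
  · have h7 : f.coeff j = -1 := by rw [h6] at hprod; linarith
    rw [h6, h7]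
    linear_combination hsq i + hsq j - 2 * hsign
  · have h7 : f.coeff j = 1 := by rw [h6] at hprod; linarith
    rw [h6, h7]
    linear_combination hsq i + hsq j - 2 * hsign

-- If l = r(t)/s(t), transcendence turns the quadratic equation into a polynomial identity. Clearing
-- denominators and completing the square makes F² + 4X^m a square, where F is the trace times X^N
-- and m = e + 2N is still odd.
open Polynomial in
theorem eval₂_neg_one_sq_of_root {E : Subfield ℝ} {t : ℝˣ} (ht : Transcendental E (t : ℝ))
    {τ : LaurentPolynomial ℤ} {e : ℤ} (he : Odd e) {l : ℝ}
    (hl : l ∈ IntermediateField.adjoin E {(t : ℝ)})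
    (hroot : l ^ 2 = LaurentPolynomial.eval₂ (Int.castRingHom ℝ) t τ * l + (t : ℝ) ^ e) :
    LaurentPolynomial.eval₂ (RingHom.id ℤ) (-1) τ ^ 2 = 4 := by
  obtain ⟨N₀, f₀, hf₀⟩ := τ.exists_T_pow
  obtain ⟨N, f, hf, hN⟩ : ∃ (N : ℕ) (f : ℤ[X]), toLaurent f = τ * LaurentPolynomial.T N ∧
      0 ≤ e + 2 * N := by
    refine ⟨N₀ + e.natAbs, f₀ * X ^ e.natAbs, ?_, by
      push_cast
      have := neg_abs_le e
      have := abs_nonneg e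
      omega⟩
    rw [map_mul, hf₀, toLaurent_X_pow, mul_assoc, ← LaurentPolynomial.T_add]
    push_cast
    rfl
  obtain ⟨m, hm⟩ := Int.eq_ofNat_of_zero_le hN
  have hmodd : Odd m := by
    rw [← Int.odd_coe_nat, ← hm]
    exact he.add_even ⟨N, by ring⟩
  have hft : aeval (t : ℝ) f =
      LaurentPolynomial.eval₂ (Int.castRingHom ℝ) t τ * (t : ℝ) ^ N := by
    have := congrArg (LaurentPolynomial.eval₂ (Int.castRingHom ℝ) t) hf
    rw [LaurentPolynomial.eval₂_toLaurent, map_mul, LaurentPolynomial.eval₂_T_n] at this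
    rw [← this, aeval_def]
    rfl
  have hf1 : f.eval (-1) =
      LaurentPolynomial.eval₂ (RingHom.id ℤ) (-1) τ * (-1) ^ N := by
    have := congrArg (LaurentPolynomial.eval₂ (RingHom.id ℤ) (-1)) hf
    rw [LaurentPolynomial.eval₂_toLaurent, map_mul, LaurentPolynomial.eval₂_T_n] at this
    simpa [eval₂_id] using this
  have hsq : f.eval (-1) ^ 2 = LaurentPolynomial.eval₂ (RingHom.id ℤ) (-1) τ ^ 2 := by
    rw [hf1, mul_pow, ← pow_mul, mul_comm N, pow_mul]
    simp
  rw [← hsq]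
  obtain ⟨r, s, rfl⟩ := (IntermediateField.mem_adjoin_simple_iff E l).1 hl
  have ht0 : (t : ℝ) ≠ 0 := t.ne_zero
  have hs0 : aeval (t : ℝ) s ≠ 0 := by
    intro h0
    -- A vanishing denominator would make l the default value 0, contradicting t^e ≠ 0.
    rw [h0, div_zero] at hroot
    have : (t : ℝ) ^ e ≠ 0 := zpow_ne_zero _ ht0
    simp_all
  set F := f.map (Int.castRingHom E) with hF
  have hFt : aeval (t : ℝ) F = aeval (t : ℝ) f := by
    rw [hF, aeval_def, eval₂_map, aeval_def]
    congr 1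
  have hpow : (t : ℝ) ^ e * ((t : ℝ) ^ N) ^ 2 = (t : ℝ) ^ m := by
    rw [← pow_mul, ← zpow_natCast, ← zpow_natCast, ← zpow_add₀ ht0]
    congr 1
    push_cast
    linarith
  have hreal : (r * X ^ N) ^ 2 = F * (r * X ^ N) * s + X ^ m * s ^ 2 := by
    have hinj := transcendental_iff_injective.1 ht
    refine hinj ?_
    simp only [map_mul, map_pow, map_add, aeval_X, hFt, hft]
    rw [← hpow]
    field_simp at hroot
    linear_combination ((t : ℝ) ^ N) ^ 2 * hroot
  have hkey : (2 * (r * X ^ N) - F * s) ^ 2 = s ^ 2 * (F ^ 2 + 4 * X ^ m) := by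
    linear_combination 4 * hreal
  -- The polynomial ring is integrally closed, so s² dividing a square gives s dividing its root; Y
  -- is the quotient.
  obtain ⟨Y, hY⟩ := (IsIntegrallyClosed.pow_dvd_pow_iff two_ne_zero).1 ⟨_, hkey⟩
  have hs : s ≠ 0 := by
    rintro rfl
    simp at hs0
  refine sq_eval_neg_one_of_sq_eq (E := E) (Y := Y) hmodd ?_
  refine mul_left_cancel₀ (pow_ne_zero 2 hs) ?_
  rw [← hkey, hY, mul_pow]

theorem linearIndependent_zpow {E : Subfield ℝ} {t : ℝ} (ht : Transcendental E t) :
    LinearIndependent E (fun m : ℤ => t ^ m) := by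
  have ht0 : t ≠ 0 := by
    rintro rfl
    exact ht isAlgebraic_zero
  rw [linearIndependent_iff']
  intro s g hg m hm
  set N := s.sup Int.natAbs with hN
  have hpos : ∀ k ∈ s, 0 ≤ k + N := fun k hk => by
    have : k.natAbs ≤ N := Finset.le_sup hk
    omega
  let p : Polynomial E := ∑ k ∈ s, Polynomial.C (g k) * Polynomial.X ^ (k + N).toNat
  have hp : Polynomial.aeval t p = t ^ N * ∑ k ∈ s, g k • t ^ k := by
    rw [map_sum, Finset.mul_sum]
    refine Finset.sum_congr rfl fun k hk => ?_
    rw [map_mul, Polynomial.aeval_C, map_pow, Polynomial.aeval_X, ← zpow_natCast,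
      Int.toNat_of_nonneg (hpos k hk), zpow_add₀ ht0, Algebra.smul_def, zpow_natCast]
    ring
  have hp0 : p = 0 := transcendental_iff.1 ht p (by rw [hp, hg, mul_zero])
  have hc := congrArg (fun q => Polynomial.coeff q (m + N).toNat) hp0
  simp only [p, Polynomial.finsetSum_coeff, Polynomial.coeff_C_mul, Polynomial.coeff_X_pow,
    Polynomial.coeff_zero] at hc
  rw [Finset.sum_eq_single m] at hc
  · simpa using hc
  · intro k hk hkm
    have h1 := hpos k hk
    have h2 := hpos m hm
    rw [if_neg (by omega), mul_zero]
  · exact fun h => absurd hm h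

/-- The evaluation of integral Laurent polynomials at a unit. -/
noncomputable def evalUnit {R : Type*} [CommRing R] (t : Rˣ) : LaurentPolynomial ℤ →+* R :=
  LaurentPolynomial.eval₂ (Int.castRingHom R) t

theorem evalUnit_T {R : Type*} [CommRing R] (t : Rˣ) (n : ℤ) :
    evalUnit t (LaurentPolynomial.T n) = (t ^ n : Rˣ) :=
  LaurentPolynomial.eval₂_T _ _ n

theorem map_evalUnit {R S : Type*} [CommRing R] [CommRing S] (φ : R →+* S) (t : Rˣ)
    (f : LaurentPolynomial ℤ) : φ (evalUnit t f) = evalUnit (Units.map φ t) f := by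
  induction f using LaurentPolynomial.induction_on' with
  | add p q hp hq => simp only [map_add, hp, hq]
  | C_mul_T n a =>
    rw [map_mul, map_mul, map_mul, evalUnit_T, evalUnit_T]
    simp [evalUnit, ← map_zpow]

theorem evalUnit_mem_adjoin (E : Subfield ℝ) (t : ℝˣ) (f : LaurentPolynomial ℤ) :
    evalUnit t f ∈ IntermediateField.adjoin E {(t : ℝ)} := by
  let t' : (IntermediateField.adjoin E {(t : ℝ)})ˣ :=
    Units.mk0 ⟨t, IntermediateField.mem_adjoin_simple_self E (t : ℝ)⟩
      (fun h => t.ne_zero (congrArg Subtype.val h))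
  have h := map_evalUnit (IntermediateField.adjoin E {(t : ℝ)}).val.toRingHom t' f
  have ht : Units.map (IntermediateField.adjoin E {(t : ℝ)}).val.toRingHom t' = t :=
    Units.ext rfl
  rw [← ht, ← h]
  exact SetLike.coe_mem _

open Matrix in
/-- A `2 × 2` matrix of Laurent polynomials with determinant `-T ^ e`, `e` odd, whose trace at `-1`
is not `± 2`, has at transcendental places eigenvectors for positive eigenvalues with coordinates
independent over the field of coefficients. -/
theorem exists_independent_eigenvector {M : Matrix (Fin 2) (Fin 2) (LaurentPolynomial ℤ)} {e : ℤ}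
    (he : Odd e) (hdet : M.det = -LaurentPolynomial.T e)
    (htr : evalUnit (-1 : ℤˣ) M.trace ^ 2 ≠ 4) (E : Subfield ℝ) (hE : Countable E) :
    ∃ ι : ℤ × Fin 2 → ℝ, (∃ (t : ℝˣ) (l : ℝ) (v : Fin 2 → ℝ), 0 < (t : ℝ) ∧ (t : ℝ) ≠ 1 ∧
      0 < l ∧ (evalUnit t).mapMatrix M *ᵥ v = l • v ∧
        ∀ m i, ι (m, i) = (t : ℝ) ^ m * v i) ∧ LinearIndependent E ι := by
  obtain ⟨t₀, ht0, htE⟩ := exists_pos_transcendental E hE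
  lift t₀ to ℝˣ using ht0.ne'.isUnit with t
  have ht1 : (t : ℝ) ≠ 1 := fun h => htE (h ▸ isAlgebraic_one)
  set A := (evalUnit t).mapMatrix M with hA
  have hAdet : A.det = -(t : ℝ) ^ e := by
    rw [hA, ← RingHom.map_det, hdet, map_neg, evalUnit_T, Units.val_zpow_eq_zpow_val]
  have hAtr : A.trace = evalUnit t M.trace := by
    simp [hA, Matrix.trace]
  have hte : 0 < (t : ℝ) ^ e := zpow_pos ht0 e
  set τ := A.trace with hτ
  set d := √(τ ^ 2 + 4 * (t : ℝ) ^ e) with hd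
  have hd2 : d ^ 2 = τ ^ 2 + 4 * (t : ℝ) ^ e := Real.sq_sqrt (by positivity)
  have hlt : |τ| < d := by
    rw [hd, ← Real.sqrt_sq_eq_abs]
    exact Real.sqrt_lt_sqrt (sq_nonneg _) (by linarith)
  -- The determinant is negative, so the roots have opposite signs; this is the positive one.
  set l := (τ + d) / 2 with hl
  have hl0 : 0 < l := by
    have := neg_abs_le τ
    rw [hl]
    linarith
  have hroot : l ^ 2 = τ * l + (t : ℝ) ^ e := by
    rw [hl]
    linear_combination hd2 / 4
  have hdet0 : (A - l • 1).det = 0 := by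
    rw [det_fin_two] at hAdet ⊢
    have : τ = A 0 0 + A 1 1 := by rw [hτ, trace_fin_two]
    simp
    linear_combination hroot + hAdet + l * this
  obtain ⟨v, hv0, hv⟩ := exists_mulVec_eq_zero_iff.2 hdet0
  have hAv : A *ᵥ v = l • v := by
    rw [sub_mulVec, smul_mulVec, one_mulVec, sub_eq_zero] at hv
    exact hv
  refine ⟨fun p => (t : ℝ) ^ p.1 * v p.2, ⟨t, l, v, ht0, ht1, hl0, hAv, fun _ _ => rfl⟩, ?_⟩
  set L := IntermediateField.adjoin E {(t : ℝ)} with hL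
  have hlL : l ∉ L := fun h => htr <|
    eval₂_neg_one_sq_of_root htE he h (by rw [hroot, hAtr]; rfl)
  have hAL : ∀ i j, A i j ∈ L := fun i j => evalUnit_mem_adjoin E t (M i j)
  have hrow : ∀ i, A i 0 * v 0 + A i 1 * v 1 = l * v i := fun i => by
    have := congrFun hAv i
    simpa [mulVec, dotProduct, Fin.sum_univ_two] using this
  -- If the ratio of the coordinates were in E(t), row j of the eigenvector equation would express l
  -- in E(t).
  have hratio : ∀ i j, i ≠ j → ∀ c ∈ L, v i ≠ c * v j := by
    intro i j hij c hc h
    have hvj : v j ≠ 0 := fun h0 => hv0 <| by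
      funext k
      obtain rfl | rfl : k = i ∨ k = j := by omega
      · simp [h, h0]
      · exact h0
    refine hlL ?_
    have hsum : A j i * v i + A j j * v j = l * v j := by
      rw [← hrow j]
      fin_cases i <;> fin_cases j <;> simp_all [add_comm]
    rw [h] at hsum
    have : l = A j i * c + A j j := mul_right_cancel₀ hvj (by linear_combination -hsum)
    rw [this]
    exact add_mem (mul_mem (hAL _ _) hc) (hAL _ _)
  have hvind : LinearIndependent L v := by
    have : v = ![v 0, v 1] := by ext i; fin_cases i <;> rfl
    rw [this, LinearIndependent.pair_iff]
    intro a b hab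
    have hab' : (a : ℝ) * v 0 + b * v 1 = 0 := hab
    have ha : a = 0 := by
      by_contra ha
      have ha' : (a : ℝ) ≠ 0 := by simpa using ha
      refine hratio 0 1 (by decide) (-b / a) (div_mem (neg_mem b.2) a.2) ?_
      field_simp
      linear_combination hab'
    refine ⟨ha, ?_⟩
    by_contra hb
    have hb' : (b : ℝ) ≠ 0 := by simpa using hb
    refine hratio 1 0 (by decide) 0 (zero_mem _) ?_
    simpa [ha, hb] using hab'
  let g : L := ⟨t, IntermediateField.mem_adjoin_simple_self E (t : ℝ)⟩
  have hgpow : ∀ m : ℤ, ((g ^ m : L) : ℝ) = (t : ℝ) ^ m := fun m => map_zpow₀ (algebraMap L ℝ) g m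
  have hg : LinearIndependent E (fun m : ℤ => g ^ m) :=
    LinearIndependent.of_comp L.val.toLinearMap <| by
      have : L.val.toLinearMap ∘ (fun m : ℤ => g ^ m) = fun m => (t : ℝ) ^ m := funext hgpow
      rw [this]
      exact linearIndependent_zpow htE
  have : (fun p : ℤ × Fin 2 => (t : ℝ) ^ p.1 * v p.2) = fun p => g ^ p.1 • v p.2 := by
    funext p
    rw [← hgpow]
    rfl
  rw [this]
  -- Tower E ⊂ E(t) ⊂ ℝ: powers of t are independent over E, the coordinates of v over E(t).
  exact linearIndependent_smul hg hvind

theorem exists_independent_fin (n : ℕ) (E : Subfield ℝ) (hE : Countable E) :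
    ∃ ι : Fin n → ℝ, True ∧ LinearIndependent E ι := by
  obtain ⟨t, -, ht⟩ := exists_pos_transcendental E hE
  exact ⟨_, trivial, (linearIndependent_zpow ht).comp (fun i : Fin n => (i : ℤ)) fun i j h => by
    simpa [Fin.ext_iff] using h⟩

end Fields

/-! ### The reduced Burau representation and crossed homomorphisms. -/

section Burau

open BraidGroup

theorem braidGroup_induction {n : ℕ} {p : BraidGroup n → Prop} (one : p 1)
    (sigma : ∀ i, p (sigma i)) (inv : ∀ β, p β → p β⁻¹) (mul : ∀ β γ, p β → p γ → p (β * γ))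
    (β : BraidGroup n) : p β := by
  let H : Subgroup (BraidGroup n) :=
    { carrier := {β | p β}
      mul_mem' := fun {a b} ha hb => mul a b ha hb
      one_mem' := one
      inv_mem' := fun {a} ha => inv a ha }
  exact PresentedGroup.generated_by _ H sigma β

theorem artinAut_mul {n : ℕ} (β γ : BraidGroup n) (x : FreeGroup (Fin n)) :
    artinAut (β * γ) x = artinAut γ (artinAut β x) := by
  simp [artinAut]

theorem artinAut_sigma {n : ℕ} (i : Fin (n - 1)) : artinAut (sigma i) = artinGen i := by
  simp [artinAut, artin, sigma]

theorem artinAut_inv_apply {n : ℕ} (β : BraidGroup n) (x : FreeGroup (Fin n)) :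
    artinAut β (artinAut β⁻¹ x) = x := by
  rw [← artinAut_mul, inv_mul_cancel]
  simp [artinAut]

/-- The total exponent of a word. -/
def freeDeg {α : Type*} : FreeGroup α →* Multiplicative ℤ :=
  FreeGroup.lift fun _ => Multiplicative.ofAdd 1

theorem freeDeg_of {α : Type*} (a : α) :
    freeDeg (FreeGroup.of a) = Multiplicative.ofAdd 1 := by simp [freeDeg]

theorem freeDeg_artinAut {n : ℕ} (β : BraidGroup n) (x : FreeGroup (Fin n)) :
    freeDeg (artinAut β x) = freeDeg x := by
  induction β using braidGroup_induction generalizing x with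
  | one => simp [artinAut]
  | sigma i =>
    have : freeDeg.comp (artinAut (sigma i)).toMonoidHom = (freeDeg (α := Fin n)) := by
      ext j
      rw [artinAut_sigma]
      simp only [MonoidHom.comp_apply, MulEquiv.toMonoidHom_eq_coe, MonoidHom.coe_coe, artinGen_of]
      split_ifs <;> simp [freeDeg_of]
    exact DFunLike.congr_fun this x
  | inv β h => rw [← h, artinAut_inv_apply]
  | mul β γ hβ hγ => rw [artinAut_mul, hγ, hβ]

/-- The reduced Burau matrices of the two standard generators of `B₃`. -/
def burauGenMatrix {R : Type*} [CommRing R] (t : R) (i : Fin 2) : Matrix (Fin 2) (Fin 2) R :=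
  if i = 0 then !![-t, 0; 1, 1] else !![1, t; 0, -t]

theorem det_burauGenMatrix {R : Type*} [CommRing R] (t : R) (i : Fin 2) :
    (burauGenMatrix t i).det = -t := by
  fin_cases i <;> simp [burauGenMatrix, Matrix.det_fin_two]

/-- The reduced Burau matrices of the generators, as invertible matrices. -/
noncomputable def burauGen {R : Type*} [CommRing R] (t : Rˣ) (i : Fin 2) : GL (Fin 2) R :=
  Matrix.GeneralLinearGroup.mk'' (burauGenMatrix (t : R) i) <| by
    rw [det_burauGenMatrix]
    exact t.isUnit.neg

theorem burauGen_braid {R : Type*} [CommRing R] (t : Rˣ) :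
    burauGen t 0 * burauGen t 1 * burauGen t 0 = burauGen t 1 * burauGen t 0 * burauGen t 1 := by
  apply Units.ext
  change burauGenMatrix _ 0 * burauGenMatrix _ 1 * burauGenMatrix _ 0 =
    burauGenMatrix _ 1 * burauGenMatrix _ 0 * burauGenMatrix _ 1
  ext i j
  fin_cases i <;> fin_cases j <;> simp [burauGenMatrix, Matrix.mul_apply, Fin.sum_univ_two]

theorem burauGen_rel {R : Type*} [CommRing R] (t : Rˣ) (r : FreeGroup (Fin (3 - 1)))
    (hr : BraidRel 3 r) : FreeGroup.lift (burauGen t) r = 1 := by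
  cases hr with
  | braid i j h =>
    obtain ⟨rfl, rfl⟩ : i = (0 : Fin 2) ∧ j = (1 : Fin 2) := by
      constructor <;> ext <;> simp <;> omega
    simp only [map_mul, map_inv, FreeGroup.lift_apply_of, mul_inv_eq_one]
    exact burauGen_braid t
  | comm i j h => omega

/-- The reduced Burau representation of `B₃` at a unit `t`. -/
noncomputable def burau {R : Type*} [CommRing R] (t : Rˣ) : BraidGroup 3 →* GL (Fin 2) R :=
  PresentedGroup.toGroup (rels := {r : FreeGroup (Fin (3 - 1)) | BraidRel 3 r})
    (f := burauGen t) (burauGen_rel t)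

theorem burau_sigma {R : Type*} [CommRing R] (t : Rˣ) (i : Fin (3 - 1)) :
    (burau t (sigma i)).val = burauGenMatrix (t : R) i := by
  simp [burau, sigma, burauGen]

theorem burau_map {R S : Type*} [CommRing R] [CommRing S] (φ : R →+* S) (t : Rˣ)
    (β : BraidGroup 3) :
    φ.mapMatrix (burau t β).val = (burau (Units.map (φ : R →* S) t) β).val := by
  have : (Matrix.GeneralLinearGroup.map φ).comp (burau t) =
      burau (Units.map (φ : R →* S) t) := by
    refine PresentedGroup.ext fun i => Units.ext ?_
    change φ.mapMatrix (burau t (sigma i)).val = (burau _ (sigma i)).val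
    rw [burau_sigma, burau_sigma]
    ext a b
    fin_cases i <;> fin_cases a <;> fin_cases b <;> simp [burauGenMatrix]
  exact congrArg Units.val (DFunLike.congr_fun this β)

/-- Crossed homomorphisms of a free group to `R`, on which a word `g` acts as `t ^ deg g`. -/
def IsCrossedHom {α R : Type*} [CommRing R] (t : Rˣ) (u : FreeGroup α → R) : Prop :=
  ∀ g h, u (g * h) = u g + (t ^ (Multiplicative.toAdd (freeDeg g)) : Rˣ) * u h

theorem IsCrossedHom.comp_artinAut {n : ℕ} {R : Type*} [CommRing R] {t : Rˣ}
    {u : FreeGroup (Fin n) → R} (hu : IsCrossedHom t u) (β : BraidGroup n) :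
    IsCrossedHom t (u ∘ artinAut β) := fun g h => by
  simp only [Function.comp_apply, map_mul, hu _ _, freeDeg_artinAut]

theorem IsCrossedHom.map_one {α R : Type*} [CommRing R] {t : Rˣ} {u : FreeGroup α → R}
    (hu : IsCrossedHom t u) : u 1 = 0 := by
  simpa using hu 1 1

theorem IsCrossedHom.map_inv {α R : Type*} [CommRing R] {t : Rˣ} {u : FreeGroup α → R}
    (hu : IsCrossedHom t u) (g : FreeGroup α) :
    u g⁻¹ = -(t ^ (-Multiplicative.toAdd (freeDeg g)) : Rˣ) * u g := by
  have h := hu g⁻¹ g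
  rw [inv_mul_cancel, hu.map_one, _root_.map_inv, toAdd_inv] at h
  linear_combination -h

/-- The differences of the values of `u` on consecutive generators of `F₃`. -/
def genDiff {R : Type*} [CommRing R] (u : FreeGroup (Fin 3) → R) : Fin 2 → R :=
  ![u (FreeGroup.of 0) - u (FreeGroup.of 1), u (FreeGroup.of 1) - u (FreeGroup.of 2)]

open Matrix in
-- For a generator this is u(aba⁻¹) = (1 - t)u(a) + t u(b). Precomposition reverses the right
-- action, so the matrices multiply in the order of the braids. The crossed homomorphism varies in
-- the induction, as products and inverses need it at a composite.
theorem genDiff_comp_artinAut {R : Type*} [CommRing R] {t : Rˣ} {u : FreeGroup (Fin 3) → R}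
    (hu : IsCrossedHom t u) (β : BraidGroup 3) :
    genDiff (u ∘ artinAut β) = (burau t β).val *ᵥ genDiff u := by
  induction β using braidGroup_induction generalizing u with
  | one =>
    have : u ∘ artinAut (1 : BraidGroup 3) = u := by
      funext x
      simp [artinAut]
    rw [this, map_one, Units.val_one, one_mulVec]
  | sigma i =>
    rw [burau_sigma, artinAut_sigma]
    have hconj : ∀ a b : Fin 3, u (FreeGroup.of a * FreeGroup.of b * (FreeGroup.of a)⁻¹) =
        (1 - (t : R)) * u (FreeGroup.of a) + t * u (FreeGroup.of b) := by
      intro a b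
      rw [hu, hu, hu.map_inv, map_mul, freeDeg_of, freeDeg_of]
      have : ((t ^ (2 : ℤ) : Rˣ) : R) * (t ^ (-1 : ℤ) : Rˣ) = t := by
        rw [← Units.val_mul, ← _root_.zpow_add]
        simp
      simp only [toAdd_mul, toAdd_ofAdd, one_add_one_eq_two, zpow_one]
      linear_combination -(u (FreeGroup.of a)) * this
    ext j
    fin_cases i <;> fin_cases j <;>
      simp [genDiff, artinGen_of, fst, snd, hconj, burauGenMatrix, mulVec, dotProduct,
        Fin.sum_univ_two, Fin.ext_iff] <;> ring
  | inv β h =>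
    have h1 := h (hu.comp_artinAut β⁻¹)
    have h2 : (u ∘ artinAut β⁻¹) ∘ artinAut β = u := by
      funext x
      simp only [Function.comp_apply]
      rw [← artinAut_mul, mul_inv_cancel]
      simp [artinAut]
    rw [h2] at h1
    rw [h1, mulVec_mulVec, map_inv, ← Units.val_mul, inv_mul_cancel, Units.val_one, one_mulVec]
  | mul β γ hβ hγ =>
    have : u ∘ artinAut (β * γ) = (u ∘ artinAut γ) ∘ artinAut β := by
      funext x
      simp [artinAut_mul]
    rw [this, hβ (hu.comp_artinAut γ), hγ hu, mulVec_mulVec, map_mul, Units.val_mul]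

/-- Equal values on the generators make u a multiple of (t^deg - 1)/(t - 1). The hypothesis on g
says that its exponent sum is zero. -/
theorem eq_of_genDiff_eq_zero {u : FreeGroup (Fin 3) → ℝ} {t : ℝˣ} (ht : (t : ℝ) ≠ 1)
    (hu : IsCrossedHom t u) (h : genDiff u = 0) {g : FreeGroup (Fin 3)} (hg : freeDeg g = 1) :
    u g = 0 := by
  have h01 : u (FreeGroup.of 0) - u (FreeGroup.of 1) = 0 := congrFun h 0
  have h12 : u (FreeGroup.of 1) - u (FreeGroup.of 2) = 0 := congrFun h 1
  have hgen : ∀ i, u (FreeGroup.of i) = u (FreeGroup.of 0) := by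
    intro i
    fin_cases i <;> simp <;> linarith
  have key : ∀ g : FreeGroup (Fin 3), ((t : ℝ) - 1) * u g =
      ((t ^ (Multiplicative.toAdd (freeDeg g)) : ℝˣ) - 1) * u (FreeGroup.of 0) := by
    intro g
    induction g using FreeGroup.induction_on with
    | C1 => simp [hu.map_one]
    | of i => rw [hgen, freeDeg_of]; simp
    | inv_of i h =>
      rw [hu.map_inv, hgen, map_inv, freeDeg_of]
      simp
      field_simp
      ring
    | mul g h hg hh =>
      rw [hu, map_mul, toAdd_mul, zpow_add, Units.val_mul]
      linear_combination hg + (t ^ (Multiplicative.toAdd (freeDeg g)) : ℝˣ) * hh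
  have := key g
  rw [hg] at this
  simpa [sub_ne_zero.2 ht] using this

end Burau

/-! ### Underlying permutations, the Burau matrix modulo 2, and pure braids. -/

section Permutation

open BraidGroup

/-- The matrix over `ZMod 2` by which a permutation of three points acts on consecutive
differences. -/
def permMatrix (π : Equiv.Perm (Fin 3)) : Matrix (Fin 2) (Fin 2) (ZMod 2) :=
  -- Row i holds the coordinates of xᵢ - x₂ in the basis x₀ - x₁, x₁ - x₂.
  let v : Fin 3 → Fin 2 → ZMod 2 := ![![1, 1], ![0, 1], ![0, 0]]
  Matrix.of ![v (π 0) - v (π 1), v (π 1) - v (π 2)]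

theorem permMatrix_one : permMatrix 1 = 1 := by decide

theorem permMatrix_mul : ∀ π ρ, permMatrix (ρ * π) = permMatrix π * permMatrix ρ := by decide

/-- The second coordinates of the three points are 1, 1, 0, so the entry vanishes only if π fixes
the last point. -/
theorem permMatrix_apply_eq_zero :
    ∀ π, permMatrix π 0 1 = 0 → π = 1 ∨ Equiv.swap 0 1 * π = 1 := by decide

/-- The permutation `π` describes the action of the braid `β` on abelian quotients of `F₃`, and its
Burau matrix modulo `2`. -/
def HasPerm (β : BraidGroup 3) (π : Equiv.Perm (Fin 3)) : Prop :=
  (∀ (h : FreeGroup (Fin 3) →* Multiplicative ℝ) (i : Fin 3),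
    h (artinAut β (FreeGroup.of i)) = h (FreeGroup.of (π i))) ∧
  (burau (1 : (ZMod 2)ˣ) β).val = permMatrix π

theorem HasPerm.mul {β γ : BraidGroup 3} {π ρ : Equiv.Perm (Fin 3)} (hβ : HasPerm β π)
    (hγ : HasPerm γ ρ) : HasPerm (β * γ) (ρ * π) := by
  refine ⟨fun h i => ?_, ?_⟩
  · rw [artinAut_mul]
    exact (hβ.1 (h.comp (artinAut γ).toMonoidHom) i).trans (hγ.1 h _)
  · rw [map_mul, Units.val_mul, hβ.2, hγ.2, permMatrix_mul]

theorem HasPerm.inv {β : BraidGroup 3} {π : Equiv.Perm (Fin 3)} (hβ : HasPerm β π) :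
    HasPerm β⁻¹ π⁻¹ := by
  refine ⟨fun h i => ?_, ?_⟩
  · have := hβ.1 (h.comp (artinAut β⁻¹).toMonoidHom) (π⁻¹ i)
    simp only [MonoidHom.comp_apply, MulEquiv.toMonoidHom_eq_coe, MonoidHom.coe_coe,
      show π (π⁻¹ i) = i from π.apply_symm_apply i] at this
    rw [← this, ← artinAut_mul, mul_inv_cancel]
    simp [artinAut]
  · rw [map_inv]
    refine Units.inv_eq_of_mul_eq_one_right ?_
    rw [hβ.2, ← permMatrix_mul, inv_mul_cancel, permMatrix_one]

theorem hasPerm_sigma (i : Fin 2) :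
    HasPerm (sigma (n := 3) i) (Equiv.swap i.castSucc i.succ) := by
  refine ⟨fun h j => ?_, ?_⟩
  · rw [artinAut_sigma, artinGen_of]
    fin_cases i <;> fin_cases j <;> simp [fst, snd, Fin.ext_iff, Equiv.swap_apply_def]
  · rw [burau_sigma]
    fin_cases i <;> decide

theorem exists_hasPerm (β : BraidGroup 3) : ∃ π, HasPerm β π := by
  induction β using braidGroup_induction with
  | one => exact ⟨1, fun h i => by simp [artinAut], by rw [map_one, permMatrix_one]; rfl⟩
  | sigma i => exact ⟨_, hasPerm_sigma i⟩
  | inv β h => exact ⟨_, h.choose_spec.inv⟩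
  | mul β γ hβ hγ => exact ⟨_, hβ.choose_spec.mul hγ.choose_spec⟩

/-- Pure braids are order-preserving. -/
theorem HasPerm.isOrderPreserving {β : BraidGroup 3} (hβ : HasPerm β 1) :
    IsOrderPreserving β := by
  obtain ⟨E, ι, hE, hι, hind, -⟩ :=
    exists_independent_tower (fun _ => True) (exists_independent_fin 3)
  refine isOrderPreservingAut_of_cone (P := posCone ι) one_notMem_posCone
    (fun g hg h hh => mul_mem_posCone hg hh) (fun g hg h => conj_mem_posCone hg h)
    (fun g hg => mem_or_inv_mem_posCone hE hι hind hg) _ fun g hg => ?_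
  refine map_mem_posCone (ψ := (artinAut β).toMonoidHom) (fun n => ⟨1, one_pos, fun k => ?_⟩) hg
  let h : FreeGroup (Fin 3) →* Multiplicative ℝ :=
    FreeGroup.lift fun b => Multiplicative.ofAdd (ι n b)
  have : h.comp (artinAut β).toMonoidHom = h := FreeGroup.ext_hom _ _ fun i => by
    simpa using hβ.1 h i
  rw [one_mul]
  exact congrArg Multiplicative.toAdd (DFunLike.congr_fun this k)

end Permutation

/-! ### Lexicographic orderings of a free group extended by a shift. -/

section Semidirect

/-- The automorphism of the free group on `ℤ × α` that shifts the first coordinate. -/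
def shiftAut (α : Type*) : Multiplicative ℤ →* MulAut (FreeGroup (ℤ × α)) where
  toFun m := FreeGroup.freeGroupCongr
    ((Equiv.addLeft (Multiplicative.toAdd m)).prodCongr (Equiv.refl α))
  map_one' := by
    have : (FreeGroup.freeGroupCongr ((Equiv.addLeft (Multiplicative.toAdd
        (1 : Multiplicative ℤ))).prodCongr (Equiv.refl α))).toMonoidHom = MonoidHom.id _ :=
      FreeGroup.ext_hom _ _ fun p => by simp
    exact MulEquiv.ext fun x => DFunLike.congr_fun this x
  map_mul' m k := by
    have : (FreeGroup.freeGroupCongr ((Equiv.addLeft (Multiplicative.toAdd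
        (m * k))).prodCongr (Equiv.refl α))).toMonoidHom =
        (FreeGroup.freeGroupCongr ((Equiv.addLeft (Multiplicative.toAdd m)).prodCongr
          (Equiv.refl α))).toMonoidHom.comp
        (FreeGroup.freeGroupCongr ((Equiv.addLeft (Multiplicative.toAdd k)).prodCongr
          (Equiv.refl α))).toMonoidHom :=
      FreeGroup.ext_hom _ _ fun p => by simp [add_assoc, Prod.map]
    exact MulEquiv.ext fun x => DFunLike.congr_fun this x

theorem shiftAut_of {α : Type*} (m : Multiplicative ℤ) (p : ℤ × α) :
    shiftAut α m (FreeGroup.of p) = FreeGroup.of (Multiplicative.toAdd m + p.1, p.2) := by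
  simp [shiftAut, Prod.map]

theorem addChar_shiftAut {α : Type*} {p : ℤ × α → ℝ} {t : ℝˣ} {v : α → ℝ}
    (hp : ∀ m i, p (m, i) = (t : ℝ) ^ m * v i) (m : Multiplicative ℤ)
    (k : FreeGroup (ℤ × α)) :
    addChar p (shiftAut α m k) = (t ^ (Multiplicative.toAdd m) : ℝˣ) * addChar p k := by
  induction k using FreeGroup.induction_on with
  | C1 => simp
  | of a =>
    rw [shiftAut_of, addChar_of, addChar_of, hp, ← Prod.mk.eta (p := a), hp,
      zpow_add₀ t.ne_zero, Units.val_zpow_eq_zpow_val]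
    ring
  | inv_of a h => rw [map_inv, addChar_inv, addChar_inv, h]; ring
  | mul k l hk hl => rw [map_mul, addChar_mul, addChar_mul, hk, hl]; ring

/-- The lexicographic positive cone of the semidirect product. -/
def lexCone {α : Type*} (ι : ℕ → ℤ × α → ℝ) :
    Set (FreeGroup (ℤ × α) ⋊[shiftAut α] Multiplicative ℤ) :=
  {g | 1 < g.right ∨ g.right = 1 ∧ g.left ∈ posCone ι}

open SemidirectProduct in
/-- Automorphisms of `FreeGroup (ℤ × α) ⋊ ℤ` that fix the `ℤ`-component and scale all characters
`ι n` by positive factors are order-preserving. -/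
theorem isOrderPreservingAut_semidirect {α : Type*} {ι : ℕ → ℤ × α → ℝ} {E : ℕ → Subfield ℝ}
    (hE : ∀ n, E n ≤ E (n + 1)) (hι : ∀ n b, ι n b ∈ E (n + 1))
    (hind : ∀ n, LinearIndependent (E n) (ι n))
    (hshift : ∀ n, ∃ (t : ℝˣ) (v : α → ℝ), 0 < (t : ℝ) ∧ ∀ m i, ι n (m, i) = (t : ℝ) ^ m * v i)
    (φ : MulAut (FreeGroup (ℤ × α) ⋊[shiftAut α] Multiplicative ℤ))
    (hright : ∀ g, (φ g).right = g.right)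
    (hφ : ∀ n, ∃ c : ℝ, 0 < c ∧ ∀ k,
      addChar (ι n) (φ (inl k)).left = c * addChar (ι n) k) : IsOrderPreservingAut φ := by
  -- The shift scales the characters by powers of t > 0; conjugation invariance of the lexicographic
  -- cone needs this.
  have hsh : ∀ (m : Multiplicative ℤ) {k}, k ∈ posCone ι → shiftAut α m k ∈ posCone ι := by
    intro m k hk
    refine map_mem_posCone (ψ := (shiftAut α m).toMonoidHom) (fun n => ?_) hk
    obtain ⟨t, v, ht, hv⟩ := hshift n
    exact ⟨_, by rw [Units.val_zpow_eq_zpow_val]; exact zpow_pos ht _,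
      fun k => addChar_shiftAut hv m k⟩
  have hinl : ∀ g : FreeGroup (ℤ × α) ⋊[shiftAut α] Multiplicative ℤ, g.right = 1 →
      inl g.left = g := fun g hg => by ext <;> simp [hg]
  refine isOrderPreservingAut_of_cone (P := lexCone ι) ?_ ?_ ?_ ?_ φ ?_
  · rintro (h | ⟨-, h⟩)
    · exact absurd h (lt_irrefl _)
    · exact one_notMem_posCone h
  · rintro g (hg | ⟨hg, hg'⟩) h (hh | ⟨hh, hh'⟩)
    · exact Or.inl (one_lt_mul' hg hh)
    · exact Or.inl (by rwa [mul_right, hh, mul_one])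
    · exact Or.inl (by rwa [mul_right, hg, one_mul])
    · refine Or.inr ⟨by rw [mul_right, hg, hh, mul_one], ?_⟩
      rw [mul_left, hg, map_one]
      exact mul_mem_posCone hg' hh'
  · rintro g (hg | ⟨hg, hg'⟩) h
    · exact Or.inl (by rw [mul_right, mul_right, inv_right, mul_inv_cancel_comm]; exact hg)
    · refine Or.inr ⟨by rw [mul_right, mul_right, hg, inv_right, mul_one, mul_inv_cancel], ?_⟩
      have : (h * g * h⁻¹).left = h.left * shiftAut α h.right g.left * h.left⁻¹ := by
        rw [mul_left, mul_left, inv_left, mul_right, hg, mul_one, ← MulAut.mul_apply, ← map_mul,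
          mul_inv_cancel, map_one]
        rfl
      rw [this]
      exact conj_mem_posCone (hsh _ hg') _
  · intro g hg
    rcases lt_trichotomy 1 g.right with h | h | h
    · exact Or.inl (Or.inl h)
    · have hne : g.left ≠ 1 := fun h' => hg (by ext <;> simp [h', ← h])
      rcases mem_or_inv_mem_posCone hE hι hind hne with h' | h'
      · exact Or.inl (Or.inr ⟨h.symm, h'⟩)
      · refine Or.inr (Or.inr ⟨by rw [inv_right, ← h, inv_one], ?_⟩)
        rwa [inv_left, ← h, inv_one, map_one]
    · exact Or.inr (Or.inl (by rw [inv_right]; exact one_lt_inv'.2 h))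
  · rintro g (hg | ⟨hg, hg'⟩)
    · exact Or.inl (by rwa [hright])
    · refine Or.inr ⟨by rw [hright, hg], ?_⟩
      let ψ : FreeGroup (ℤ × α) →* FreeGroup (ℤ × α) :=
        { toFun := fun k => (φ (inl k)).left
          map_one' := by simp
          map_mul' := fun k l => by simp [hright] }
      rw [← hinl g hg]
      exact map_mem_posCone (ψ := ψ) hφ hg'

end Semidirect

/-! ### Splitting F₃ over the total exponent. -/

section Splitting

open SemidirectProduct

/-- The free group `F₃` as the semidirect product of the kernel of the total exponent with `ℤ`. -/
def toSemidirect : FreeGroup (Fin 3) →*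
    FreeGroup (ℤ × Fin 2) ⋊[shiftAut (Fin 2)] Multiplicative ℤ :=
  -- The middle generator is the stable letter. The basis elements at m = 0 are x₀x₁⁻¹ and x₁x₂⁻¹,
  -- so that a character of K restores its own vector v as `genDiff`.
  FreeGroup.lift ![inl (FreeGroup.of (0, 0)) * inr (Multiplicative.ofAdd 1),
    inr (Multiplicative.ofAdd 1),
    inl (FreeGroup.of (0, 1))⁻¹ * inr (Multiplicative.ofAdd 1)]

/-- The inverse of `toSemidirect`. -/
def ofSemidirect : FreeGroup (ℤ × Fin 2) ⋊[shiftAut (Fin 2)] Multiplicative ℤ →*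
    FreeGroup (Fin 3) :=
  SemidirectProduct.lift
    (FreeGroup.lift fun p => FreeGroup.of 1 ^ p.1 *
      ![FreeGroup.of 0 * (FreeGroup.of 1)⁻¹, FreeGroup.of 1 * (FreeGroup.of 2)⁻¹] p.2 *
      (FreeGroup.of 1 ^ p.1)⁻¹)
    (zpowersHom _ (FreeGroup.of 1)) fun m => FreeGroup.ext_hom _ _ fun p => by
      simp only [MonoidHom.comp_apply, MulEquiv.toMonoidHom_eq_coe, MonoidHom.coe_coe, shiftAut_of,
        FreeGroup.lift_apply_of, zpowersHom_apply, MulAut.conj_apply, zpow_add]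
      group

/-- `toSemidirect` as an isomorphism. -/
def semidirectEquiv : FreeGroup (Fin 3) ≃*
    FreeGroup (ℤ × Fin 2) ⋊[shiftAut (Fin 2)] Multiplicative ℤ :=
  MonoidHom.toMulEquiv toSemidirect ofSemidirect
    (FreeGroup.ext_hom _ _ fun i => by
      fin_cases i <;> simp [toSemidirect, ofSemidirect])
    (by
      refine SemidirectProduct.hom_ext (FreeGroup.ext_hom _ _ fun p => ?_)
        (MonoidHom.ext_mint ?_)
      · obtain ⟨m, i⟩ := p
        have h : ∀ i, toSemidirect (![FreeGroup.of 0 * (FreeGroup.of 1)⁻¹,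
            FreeGroup.of 1 * (FreeGroup.of 2)⁻¹] i) = inl (FreeGroup.of (0, i)) := by
          intro i
          fin_cases i <;> simp [toSemidirect]
        have h1 : toSemidirect (FreeGroup.of 1) = inr (Multiplicative.ofAdd 1) := by
          simp [toSemidirect]
        simp only [MonoidHom.comp_apply, ofSemidirect, SemidirectProduct.lift_inl,
          FreeGroup.lift_apply_of, map_mul, map_inv, map_zpow, h, h1, MonoidHom.id_apply]
        rw [← map_zpow, ← map_inv, ← inl_aut, shiftAut_of]
        simp
      · simp [toSemidirect, ofSemidirect])

theorem semidirectEquiv_right (g : FreeGroup (Fin 3)) :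
    (semidirectEquiv g).right = freeDeg g := by
  have : (rightHom.comp semidirectEquiv.toMonoidHom) = (freeDeg (α := Fin 3)) :=
    FreeGroup.ext_hom _ _ fun i => by
      fin_cases i <;> simp [semidirectEquiv, toSemidirect, freeDeg_of]
  exact DFunLike.congr_fun this g

theorem isCrossedHom_addChar {p : ℤ × Fin 2 → ℝ} {t : ℝˣ} {v : Fin 2 → ℝ}
    (hp : ∀ m i, p (m, i) = (t : ℝ) ^ m * v i) :
    IsCrossedHom t fun g : FreeGroup (Fin 3) => addChar p (semidirectEquiv g).left := by
  intro g h
  simp only [map_mul, mul_left, addChar_mul, addChar_shiftAut hp, semidirectEquiv_right]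

theorem genDiff_addChar {p : ℤ × Fin 2 → ℝ} {t : ℝˣ} {v : Fin 2 → ℝ}
    (hp : ∀ m i, p (m, i) = (t : ℝ) ^ m * v i) :
    genDiff (fun g : FreeGroup (Fin 3) => addChar p (semidirectEquiv g).left) = v := by
  ext i
  fin_cases i <;> simp [genDiff, semidirectEquiv, toSemidirect, hp]

end Splitting

/-! ### Braids of odd exponent and the final case distinction. -/

section Main

open BraidGroup Matrix

/-- The variable of the Laurent polynomials, as a unit. -/
noncomputable def laurentUnit : (LaurentPolynomial ℤ)ˣ where
  val := LaurentPolynomial.T 1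
  inv := LaurentPolynomial.T (-1)
  val_inv := by rw [← LaurentPolynomial.T_add]; simp
  inv_val := by rw [← LaurentPolynomial.T_add]; simp

theorem laurentUnit_zpow (n : ℤ) : (laurentUnit ^ n).val = LaurentPolynomial.T n := by
  cases n with
  | ofNat n => simp [laurentUnit, LaurentPolynomial.T_pow]
  | negSucc n =>
    rw [zpow_negSucc, ← inv_pow, Units.val_pow_eq_pow_val]
    change LaurentPolynomial.T (-1) ^ (n + 1) = _
    rw [LaurentPolynomial.T_pow, Int.negSucc_eq]
    congr 1
    push_cast
    ring

theorem map_evalUnit_laurentUnit {R : Type*} [CommRing R] (t : Rˣ) :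
    Units.map (evalUnit t : LaurentPolynomial ℤ →* R) laurentUnit = t :=
  Units.ext (by simpa [laurentUnit] using evalUnit_T t 1)

theorem det_burau_sigma {R : Type*} [CommRing R] (t : Rˣ) (i : Fin (3 - 1)) :
    GeneralLinearGroup.det (burau t (sigma i)) = -t :=
  Units.ext <| by
    rw [GeneralLinearGroup.val_det_apply, burau_sigma, det_burauGenMatrix, Units.val_neg]

theorem exists_det_burau {R : Type*} [CommRing R] (t : Rˣ) (β : BraidGroup 3) :
    ∃ e : ℤ, GeneralLinearGroup.det (burau t β) = (-t) ^ e := by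
  induction β using braidGroup_induction with
  | one => exact ⟨0, by simp⟩
  | sigma i => exact ⟨1, by rw [det_burau_sigma, _root_.zpow_one]⟩
  | inv β h =>
    obtain ⟨e, he⟩ := h
    exact ⟨-e, by rw [map_inv, map_inv, he, _root_.zpow_neg]⟩
  | mul β γ hβ hγ =>
    obtain ⟨e, he⟩ := hβ
    obtain ⟨f, hf⟩ := hγ
    exact ⟨e + f, by rw [map_mul, map_mul, he, hf, _root_.zpow_add]⟩

/-- A braid of odd exponent whose Burau matrix at `-1` has trace different from `± 2` is
order-preserving. -/
theorem isOrderPreserving_of_odd {β : BraidGroup 3} {e : ℤ} (he : Odd e)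
    (hdet : GeneralLinearGroup.det (burau laurentUnit β) = (-laurentUnit) ^ e)
    (htr : (burau (-1 : ℤˣ) β).val.trace ^ 2 ≠ 4) : IsOrderPreserving β := by
  have hmap : ∀ {R : Type} [CommRing R] (t : Rˣ),
      (evalUnit t).mapMatrix (burau laurentUnit β).val = (burau t β).val := by
    intro R _ t
    rw [burau_map, map_evalUnit_laurentUnit]
  have hdet' : (burau laurentUnit β).val.det = -LaurentPolynomial.T e := by
    have h := congrArg Units.val hdet
    rw [GeneralLinearGroup.val_det_apply] at h
    rw [h, ← laurentUnit_zpow]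
    obtain ⟨k, rfl⟩ := he
    rw [_root_.zpow_add, _root_.zpow_add, _root_.zpow_mul, _root_.zpow_mul]
    simp
  have htr' : evalUnit (-1 : ℤˣ) (burau laurentUnit β).val.trace ^ 2 ≠ 4 := by
    rw [← hmap (-1 : ℤˣ)] at htr
    simpa [trace_fin_two] using htr
  obtain ⟨E, ι, hE, hι, hind, hQ⟩ :=
    exists_independent_tower _ (exists_independent_eigenvector he hdet' htr')
  refine IsOrderPreservingAut.of_mulEquiv semidirectEquiv
    (ψ := semidirectEquiv.symm.trans ((artinAut β).trans semidirectEquiv)) (fun g => by simp)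
    (isOrderPreservingAut_semidirect hE hι hind (fun n => ?_) _ (fun g => ?_) (fun n => ?_))
  · obtain ⟨t, -, v, ht, -, -, -, hv⟩ := hQ n
    exact ⟨t, v, ht, hv⟩
  · obtain ⟨g, rfl⟩ := semidirectEquiv.surjective g
    simp [semidirectEquiv_right, freeDeg_artinAut]
  · obtain ⟨t, l, v, -, ht1, hl, heig, hv⟩ := hQ n
    refine ⟨l, hl, fun k => ?_⟩
    set u : FreeGroup (Fin 3) → ℝ := fun g => addChar (ι n) (semidirectEquiv g).left with hu
    have hcr : IsCrossedHom t u := isCrossedHom_addChar hv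
    have hgd : genDiff u = v := genDiff_addChar hv
    have hgd' := genDiff_comp_artinAut hcr β
    rw [hgd, ← hmap, heig] at hgd'
    -- The eigenvector equation only controls differences on generators; this crossed homomorphism
    -- has none, so it vanishes on the kernel of the exponent, where β thus scales the character by
    -- l.
    have hw : IsCrossedHom t (fun g => u (artinAut β g) - l * u g) := fun g h => by
      have h1 := hcr.comp_artinAut β g h
      simp only [Function.comp_apply] at h1
      simp only [h1, hcr g h]
      ring
    have hw0 : genDiff (fun g => u (artinAut β g) - l * u g) = 0 := by
      have h0 := congrFun hgd' 0
      have h1 := congrFun hgd' 1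
      rw [← hgd] at h0 h1
      simp [genDiff] at h0 h1
      ext i
      fin_cases i <;> simp [genDiff] <;> linarith
    obtain ⟨g, hg⟩ := semidirectEquiv.surjective (SemidirectProduct.inl k)
    have hdeg : freeDeg g = 1 := by
      rw [← semidirectEquiv_right, hg, SemidirectProduct.right_inl]
    have := eq_of_genDiff_eq_zero ht1 hw hw0 hdeg
    simp only [hu, hg, SemidirectProduct.left_inl] at this
    rw [← hg]
    simpa [sub_eq_zero] using this

/-- If the off-diagonal entry of the Burau matrix at `-1` is odd, then a braid of odd exponent
becomes order-preserving after multiplication by `1` or by `σ₁ ^ 2`. -/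
theorem exists_isOrderPreserving_mul_sq {γ : BraidGroup 3} {e : ℤ} (he : Odd e)
    (hdet : GeneralLinearGroup.det (burau laurentUnit γ) = (-laurentUnit) ^ e)
    (hγ : Odd ((burau (-1 : ℤˣ) γ).val 0 1)) :
    IsOrderPreserving γ ∨ IsOrderPreserving (γ * sigma (n := 3) 0 ^ 2) := by
  by_cases htr : (burau (-1 : ℤˣ) γ).val.trace ^ 2 = 4
  · right
    refine isOrderPreserving_of_odd (e := e + 2) (he.add_even even_two) ?_ ?_
    · rw [map_mul, map_mul, hdet, map_pow, map_pow, det_burau_sigma, _root_.zpow_add, zpow_ofNat]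
    · have htr2 : (burau (-1 : ℤˣ) (γ * sigma (n := 3) 0 ^ 2)).val.trace =
          (burau (-1 : ℤˣ) γ).val.trace + 2 * (burau (-1 : ℤˣ) γ).val 0 1 := by
        rw [map_mul, map_pow, Units.val_mul, Units.val_pow_eq_pow_val, burau_sigma,
          trace_fin_two, trace_fin_two, pow_two]
        simp [burauGenMatrix, Matrix.mul_apply, Fin.sum_univ_two]
        ring
      rw [htr2]
      intro h
      obtain ⟨c, hc⟩ := hγ
      rw [hc] at h
      have h1 : (burau (-1 : ℤˣ) γ).val.trace = 2 ∨ (burau (-1 : ℤˣ) γ).val.trace = -2 :=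
        sq_eq_sq_iff_eq_or_eq_neg.1 (htr.trans (by norm_num))
      have h2 := sq_eq_sq_iff_eq_or_eq_neg.1 (h.trans (show (4 : ℤ) = 2 ^ 2 by norm_num))
      -- Passing between the values ±2 by adding 2(2c + 1) is impossible: the change would be 0 or
      -- ±4.
      omega
  · exact Or.inl (isOrderPreserving_of_odd he hdet htr)

theorem propositionP (β : BraidGroup 3) :
    ∃ k : ℕ, 0 ≤ k ∧ k ≤ 3 ∧
      BraidGroup.IsOrderPreserving (β * BraidGroup.sigma (n := 3) 0 ^ k) := by
  obtain ⟨π, hπ⟩ := exists_hasPerm β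
  -- As -1 = 1 modulo 2, the integral matrix at -1 reduces to the permutation matrix.
  have hmod : (((burau (-1 : ℤˣ) β).val 0 1 : ℤ) : ZMod 2) = permMatrix π 0 1 := by
    rw [← hπ.2]
    have h := burau_map (Int.castRingHom (ZMod 2)) (-1) β
    have h1 : Units.map (Int.castRingHom (ZMod 2) : ℤ →* ZMod 2) (-1) = 1 := by decide
    rw [h1] at h
    rw [← h]
    rfl
  rcases Int.even_or_odd ((burau (-1 : ℤˣ) β).val 0 1) with hc | hc
  · have h0 : permMatrix π 0 1 = 0 := by
      rw [← hmod, ZMod.intCast_zmod_eq_zero_iff_dvd]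
      exact_mod_cast hc.two_dvd
    rcases permMatrix_apply_eq_zero π h0 with rfl | h1
    · exact ⟨0, le_rfl, by norm_num, by simpa using hπ.isOrderPreserving⟩
    · refine ⟨1, by norm_num, by norm_num, HasPerm.isOrderPreserving ?_⟩
      rw [pow_one, ← h1]
      exact hπ.mul (hasPerm_sigma 0)
  · obtain ⟨e, he⟩ := exists_det_burau laurentUnit β
    rcases Int.even_or_odd e with hev | hodd
    · have hdet : GeneralLinearGroup.det (burau laurentUnit (β * sigma (n := 3) 0)) =
          (-laurentUnit) ^ (e + 1) := by
        rw [map_mul, map_mul, he, det_burau_sigma, _root_.zpow_add, _root_.zpow_one]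
      -- The matrix of σ₁ at -1 is lower unitriangular, so right multiplication by it keeps the
      -- second column.
      have hentry : (burau (-1 : ℤˣ) (β * sigma (n := 3) 0)).val 0 1 =
          (burau (-1 : ℤˣ) β).val 0 1 := by
        rw [map_mul, Units.val_mul, burau_sigma]
        simp [burauGenMatrix, Matrix.mul_apply, Fin.sum_univ_two]
      rcases exists_isOrderPreserving_mul_sq hev.add_one hdet (hentry ▸ hc) with h | h
      · exact ⟨1, by norm_num, by norm_num, by simpa using h⟩
      · exact ⟨3, by norm_num, le_rfl, by rwa [mul_assoc, ← pow_succ'] at h⟩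
    · rcases exists_isOrderPreserving_mul_sq hodd he hc with h | h
      · exact ⟨0, le_rfl, by norm_num, by simpa using h⟩
      · exact ⟨2, by norm_num, by norm_num, h⟩

end Main
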